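/- **Proposition 5.4.** Let $R$ be a reduced irreducible crystallographic root system with simple roots $\alpha_1,\dots,\alpha_n$, positive roots $R_+$, Weyl group $W$, and weight lattice $P$ with fundamental weights $\omega_1,\dots,\omega_n$. Normalize the $W$-invariant form by $(\alpha,\alpha)=2$ for short roots (all roots are short if they have the same length), put $\nu_\alpha=(\alpha,\alpha)/2$, let $\vartheta$ be the maximal short root, and let $m\ge 1$ be the least integer with $m(P,P)\subset\mathbb Z$. *Dunkl operators.* Let $K$ be the field generated over $\mathbb Q$ by independent variables $q^{1/(2m)}$ and $t_\nu^{1/2}$ (one for each value $\nu$ of $\nu_\alpha$), and put $t_\alpha=t_{\nu_\alpha}$. Let $K(X)$ be the fraction field of the group algebra $K[X_a,\ a\in P]$, and let $\Gamma_b(X_a)=q^{(a,b)}X_a$ and $w(X_a)=X_{w(a)}$ for $b\in P$, $w\in W$. The extended affine Weyl group $\widehat W=W\ltimes P$ acts on $K(X)$ through these operators, $b\in P$ acting as $\Gamma_{-b}$, and it acts on vectors $[z,\zeta]$ by $w[z,\zeta]=[w(z),\zeta]$, $b[z,\zeta]=[z,\zeta-(z,b)]$. Put $\alpha_0=[-\vartheta,1]$,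 $\alpha_i=[\alpha_i,0]$ for $i>0$; let $s_0,\dots,s_n$ be the corresponding reflections in $\widehat W$, let $\Pi\subset\widehat W$ be the subgroup of elements permuting $\alpha_0,\dots,\alpha_n$, and put $X_{\alpha_0}=qX_\vartheta^{-1}$, $t_0=t_\vartheta$, $t_i=t_{\alpha_i}$. In the algebra $\mathcal A$ of difference-reflection operators $\sum g_{b,w}\Gamma_b w$, $g_{b,w}\in K(X)$, let $$T_i=t_i^{1/2}s_i+\frac{t_i^{1/2}-t_i^{-1/2}}{X_{\alpha_i}-1}(s_i-1)\quad(0\le i\le n),\qquad T_g=\pi T_{i_1}\cdots T_{i_l}$$ for a reduced decomposition $g=\pi s_{i_1}\cdots s_{i_l}\in\widehat W$, $\pi\in\Pi$, and let $Y_b=\prod_{i=1}^n T_{\omega_i}^{(b,\alpha_i^\vee)}$ for $b\in P$ (here $\omega_i$ is considered as an element of $\widehat W$). *The limit.* A spinor is a family $f=(f_u)_{u\in W}$ of elements of $K(X)$, with pointwise operations; $\zeta_u$ is the $u$-th coordinate idempotent, $\Gamma_b$ acts on spinors componentwise, and $(\delta(v)f)_u=f_{v^{-1}u}$. Let $\phi$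 map $g\,\Gamma_b w\in\mathcal A$ to the difference-spin operator $$\varrho(g)\,\varrho(\Gamma_b)\,\delta(w),\qquad \varrho(g)=\sum_{u\in W}u^{-1}(g)\,\zeta_u,\quad \varrho(\Gamma_b)=\sum_{u\in W}\Gamma_{u^{-1}(b)}\,\zeta_u,$$ and extend $\phi$ additively. Let $q^{(\rho_k,a)}=\prod_{\alpha\in R_+}t_\alpha^{(a,\alpha^\vee)/2}$ for $a\in P$, and let $\mathfrak{ae}^\delta(L)$ be obtained from $\phi(L)$ by replacing every $X_a$ by $q^{-(\rho_k,a)}X_a$ and every $\Gamma_a$ by $q^{-(\rho_k,a)}\Gamma_a$, which is the conjugation by $X_{\rho_k}\Gamma_{-\rho_k}$ acting diagonally on spinors. Writing $\mathfrak{ae}^\delta(L)=\sum_{c\in P,\ v,u\in W}f_{c,v,u}\,\zeta_u\,\Gamma_c\,\delta(v)$ with $f_{c,v,u}\in K(X)$, one says that $RE^\delta(L)=\lim_{t_\nu\to0}\mathfrak{ae}^\delta(L)$ exists if every coefficient $f_{c,v,u}$ is regular at the point where all $t_\nu^{1/2}$ are $0$, that is, is a quotient of two polynomials in the $X_a$ and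 the $t_\nu^{1/2}$ over $\mathbb Q(q^{1/(2m)})$ whose denominator does not vanish identically in $X$ when all $t_\nu^{1/2}$ are set to $0$; then $RE^\delta(L)$ is the difference-spin operator whose coefficients are the values of these quotients there. *Claim.* The limit $RE^\delta(Y_b)$ exists when 1. $b=\omega_r$ is a minuscule weight, i.e. $(\omega_r,\alpha^\vee)\le1$ for all $\alpha\in R_+$; 2. $b$ is a short positive root; 3. $b=-\omega_r$ for a minuscule weight $\omega_r$; 4. $b$ is a short negative root; and it exists for every $b\in P$; that is, the Toda–Dunkl operators $\widehat Y_b=RE^\delta(Y_b)$ exist for all weights $b\in P$. -/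

import Mathlib

noncomputable section

set_option linter.unusedSectionVars false

namespace TodaDunkl

/-! ## Automorphisms of group algebras of lattices -/

section GroupAlgebra

variable {k A : Type*} [Field k] [AddCommGroup A]

/-- The `k`-algebra endomorphism `X_a ↦ χ(a) X_a` of the group algebra `k[A]`. -/
def twistHom (χ : Multiplicative A →* kˣ) : AddMonoidAlgebra k A →ₐ[k] AddMonoidAlgebra k A :=
  AddMonoidAlgebra.lift k (AddMonoidAlgebra k A) A
    { toFun := fun a => AddMonoidAlgebra.single a.toAdd (χ a : k)
      map_one' := by simp [AddMonoidAlgebra.one_def]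
      map_mul' := fun a b => by simp [AddMonoidAlgebra.single_mul_single] }

lemma twistHom_single (χ : Multiplicative A →* kˣ) (a : A) (c : k) :
    twistHom χ (AddMonoidAlgebra.single a c) =
      AddMonoidAlgebra.single a (χ (Multiplicative.ofAdd a) * c) := by
  simp [twistHom, AddMonoidAlgebra.lift_single, mul_comm]

/-- The automorphism `X_a ↦ χ(a) X_a` of `k[A]`, as a homomorphism in the character `χ`. -/
def twist : (Multiplicative A →* kˣ) →*
    (AddMonoidAlgebra k A ≃+* AddMonoidAlgebra k A) where
  toFun χ := (AlgEquiv.ofAlgHom (twistHom χ) (twistHom χ⁻¹)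
    (by ext a; simp [twistHom_single]) (by ext a; simp [twistHom_single])).toRingEquiv
  map_one' := by
    ext x : 1
    have : twistHom (1 : Multiplicative A →* kˣ) = AlgHom.id k _ := by
      ext a; simp [twistHom_single]
    exact DFunLike.congr_fun this x
  map_mul' χ ψ := by
    ext x : 1
    have : twistHom (χ * ψ) = (twistHom χ).comp (twistHom ψ) := by
      ext a; simp [twistHom_single, mul_comm]
    exact DFunLike.congr_fun this x

lemma twist_single (χ : Multiplicative A →* kˣ) (a : A) (c : k) :
    twist χ (AddMonoidAlgebra.single a c) =
      AddMonoidAlgebra.single a (χ (Multiplicative.ofAdd a) * c) :=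
  twistHom_single χ a c

/-- A group acting on the lattice `A` acts on `k[A]` by `X_a ↦ X_{g a}`. -/
def permute {G : Type*} [Group G] [DistribMulAction G A] :
    G →* (AddMonoidAlgebra k A ≃+* AddMonoidAlgebra k A) where
  toFun g := (AddMonoidAlgebra.domCongr k k (DistribMulAction.toAddEquiv A g)).toRingEquiv
  map_one' := by
    ext x : 1
    have : (AddMonoidAlgebra.domCongr k k (DistribMulAction.toAddEquiv A (1 : G))).toAlgHom =
        AlgHom.id k _ := by
      ext a; simp
    exact DFunLike.congr_fun this x
  map_mul' g h := by
    ext x : 1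
    have : (AddMonoidAlgebra.domCongr k k (DistribMulAction.toAddEquiv A (g * h))).toAlgHom =
        (AddMonoidAlgebra.domCongr k k (DistribMulAction.toAddEquiv A g)).toAlgHom.comp
          (AddMonoidAlgebra.domCongr k k (DistribMulAction.toAddEquiv A h)).toAlgHom := by
      ext a; simp [mul_smul]
    exact DFunLike.congr_fun this x

lemma permute_single {G : Type*} [Group G] [DistribMulAction G A] (g : G) (a : A) (c : k) :
    permute g (AddMonoidAlgebra.single a c) = AddMonoidAlgebra.single (g • a) c := by
  exact AddMonoidAlgebra.domCongr_single (R := k) (A := k) (DistribMulAction.toAddEquiv A g) a c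

end GroupAlgebra

/-! ## The normalized form, the weight lattice and the extended affine Weyl group -/

section Lattice

variable {ι M N : Type*} [Fintype ι] [AddCommGroup M] [Module ℝ M] [AddCommGroup N] [Module ℝ N]
  (P : RootPairing ι ℝ M N)

/-- The `W`-invariant form `( , )`, normalized so that `(α, α) = 2` for the shortest roots. -/
def form (x y : M) : ℝ :=
  2 * P.RootForm x y / ⨅ i, P.RootForm (P.root i) (P.root i)

/-- `ν_α = (α, α) / 2`. -/
def nu (i : ι) : ℝ := form P (P.root i) (P.root i) / 2

/-- Short roots. All roots are short if they have the same length. -/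
def IsShort (i : ι) : Prop := nu P i = 1

/-- The weight lattice `P = {x : (x, α^∨) ∈ ℤ for all roots α}`. -/
def weightLattice : AddSubgroup M where
  carrier := {x | ∀ i, ∃ n : ℤ, P.toLinearMap x (P.coroot i) = n}
  zero_mem' i := ⟨0, by simp⟩
  add_mem' {x y} hx hy i := by
    obtain ⟨a, ha⟩ := hx i
    obtain ⟨c, hc⟩ := hy i
    exact ⟨a + c, by simp [ha, hc]⟩
  neg_mem' {x} hx i := by
    obtain ⟨a, ha⟩ := hx i
    exact ⟨-a, by simp [ha]⟩

/-- The integer `(x, α_i^∨)` for a weight `x`. -/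
def pair (x : weightLattice P) (i : ι) : ℤ := (x.2 i).choose

lemma pair_spec (x : weightLattice P) (i : ι) :
    P.toLinearMap (x : M) (P.coroot i) = (pair P x i : ℝ) := (x.2 i).choose_spec

lemma pair_add (x y : weightLattice P) (i : ι) : pair P (x + y) i = pair P x i + pair P y i := by
  have h := pair_spec P (x + y) i
  rw [AddSubgroup.coe_add, map_add, LinearMap.add_apply, pair_spec, pair_spec] at h
  exact_mod_cast h.symm

lemma root_mem_weightLattice [P.IsCrystallographic] (i : ι) : P.root i ∈ weightLattice P := by
  intro j
  obtain ⟨z, hz⟩ := P.exists_value (S := ℤ) i j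
  exact ⟨z, by simpa using hz.symm⟩

/-- A root considered as a weight. -/
def rootWeight [P.IsCrystallographic] (i : ι) : weightLattice P :=
  ⟨P.root i, root_mem_weightLattice P i⟩

lemma smul_mem_weightLattice [P.IsCrystallographic] (w : P.weylGroup) {x : M}
    (hx : x ∈ weightLattice P) : w • x ∈ weightLattice P := by
  obtain ⟨w, hw⟩ := w
  change w • x ∈ weightLattice P
  induction hw using RootPairing.weylGroup.induction generalizing x with
  | mem i =>
    rw [RootPairing.Equiv.reflection_smul, RootPairing.reflection_apply]
    obtain ⟨n, hn⟩ := hx i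
    refine sub_mem hx ?_
    have : P.toLinearMap x (P.coroot i) • P.root i = n • P.root i := by
      rw [hn, Int.cast_smul_eq_zsmul]
    change P.toLinearMap x (P.coroot i) • P.root i ∈ _
    rw [this]
    exact zsmul_mem (root_mem_weightLattice P i) n
  | one => simpa using hx
  | mul u v hu hv h1 h2 => rw [mul_smul]; exact h1 (h2 hx)

instance [P.IsCrystallographic] : DistribMulAction P.weylGroup (weightLattice P) where
  smul w x := ⟨w • (x : M), smul_mem_weightLattice P w x.2⟩
  one_smul x := Subtype.ext (one_smul _ (x : M))
  mul_smul u v x := Subtype.ext (mul_smul u v (x : M))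
  smul_zero w := Subtype.ext (smul_zero w)
  smul_add w x y := Subtype.ext (smul_add w (x : M) (y : M))

lemma form_smul_smul (w : P.weylGroup) (x y : M) : form P (w • x) (w • y) = form P x y := by
  have : P.RootForm (w • x) (w • y) = P.RootForm x y := by
    obtain ⟨w, hw⟩ := w
    change P.RootForm (w • x) (w • y) = P.RootForm x y
    induction hw using RootPairing.weylGroup.induction generalizing x y with
    | mem i => exact P.rootForm_reflection_reflection_apply i x y
    | one => simp
    | mul u v hu hv h1 h2 => rw [mul_smul, mul_smul, h1, h2]
  rw [form, form, this]

lemma exists_denominator [P.IsCrystallographic] :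
    ∃ m : ℕ, 0 < m ∧ ∀ x y : weightLattice P, ∃ z : ℤ, m * form P x y = z := by
  have hint : ∀ x y : weightLattice P, ∃ z : ℤ, P.RootForm (x : M) (y : M) = z := fun x y => by
    refine ⟨∑ i, pair P x i * pair P y i, ?_⟩
    rw [RootPairing.rootForm_apply_apply]
    push_cast
    exact Finset.sum_congr rfl fun i _ => by
      rw [← pair_spec, ← pair_spec]; rfl
  rcases isEmpty_or_nonempty ι with h | h
  · exact ⟨1, one_pos, fun x y => ⟨0, by simp [form, RootPairing.rootForm_apply_apply]⟩⟩
  · obtain ⟨i, hi⟩ := exists_eq_ciInf_of_finite (f := fun i => P.RootForm (P.root i) (P.root i))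
    obtain ⟨c, hc⟩ := hint (rootWeight P i) (rootWeight P i)
    have hc' : P.RootForm (P.root i) (P.root i) = c := hc
    have hpos : (0 : ℝ) < c := by
      rw [← hc', P.rootForm_root_self]
      refine Finset.sum_pos' (fun j _ => mul_self_nonneg _) ⟨i, Finset.mem_univ _, by simp⟩
    have hpos' : 0 < c := by exact_mod_cast hpos
    refine ⟨c.toNat, by omega, fun x y => ?_⟩
    obtain ⟨z, hz⟩ := hint x y
    refine ⟨2 * z, ?_⟩
    have e : ((c.toNat : ℕ) : ℝ) = (c : ℝ) := by exact_mod_cast Int.toNat_of_nonneg hpos'.le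
    rw [form, ← hi, hc', hz, e]
    push_cast
    field_simp

/-- The least natural number `m ≥ 1` with `m (P, P) ⊆ ℤ`. -/
def denom : ℕ := sInf {m : ℕ | 0 < m ∧ ∀ x y : weightLattice P, ∃ z : ℤ, m * form P x y = z}

lemma denom_spec [P.IsCrystallographic] :
    0 < denom P ∧ ∀ x y : weightLattice P, ∃ z : ℤ, denom P * form P x y = z :=
  Nat.sInf_mem (exists_denominator P)

/-- The constant field `ℚ_q' = ℚ(q^{1/(2m)})`; the variable is `q^{1/(2m)}`. -/
abbrev Kq : Type := RatFunc ℚ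

/-- `q^x` for `x ∈ (1/(2m)) ℤ`. -/
def qpow (x : ℝ) : Kqˣ := (Units.mk0 (RatFunc.X : Kq) RatFunc.X_ne_zero) ^ ⌊2 * denom P * x⌋

lemma qpow_add {x y : ℝ} {z : ℤ} (hx : 2 * denom P * x = z) :
    qpow P (x + y) = qpow P x * qpow P y := by
  have h2 : (2 * denom P * (x + y) : ℝ) = z + 2 * denom P * y := by
    rw [← hx]; ring
  rw [qpow, qpow, qpow, h2, hx, Int.floor_intCast_add, Int.floor_intCast, zpow_add]

lemma qpow_form_add_left [P.IsCrystallographic] (x y z : weightLattice P) :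
    qpow P (form P (x + y : weightLattice P) z) = qpow P (form P x z) * qpow P (form P y z) := by
  obtain ⟨n, hn⟩ := (denom_spec P).2 x z
  rw [← qpow_add P (z := 2 * n) (by push_cast; rw [← hn]; ring)]
  simp [form, mul_add, add_div]

lemma form_comm (x y : M) : form P x y = form P y x := by
  rw [form, form, (P.rootForm_symmetric).eq x y |>.symm]; simp

/-- The characters `a ↦ q^{(a, b)}` of the weight lattice. -/
def qchar [P.IsCrystallographic] (k : Type*) [Field k] [Algebra Kq k] :
    Multiplicative (weightLattice P) →* (Multiplicative (weightLattice P) →* kˣ) where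
  toFun b :=
    { toFun := fun a => Units.map (algebraMap Kq k).toMonoidHom (qpow P (form P a.toAdd b.toAdd))
      map_one' := by simp [form, qpow]
      map_mul' := fun x y => by rw [toAdd_mul, qpow_form_add_left, map_mul] }
  map_one' := by ext a; simp [form, qpow]
  map_mul' x y := by
    refine MonoidHom.ext fun a => ?_
    change Units.map _ (qpow P (form P a.toAdd (x * y).toAdd)) =
      Units.map _ (qpow P (form P a.toAdd x.toAdd)) * Units.map _ (qpow P (form P a.toAdd y.toAdd))
    rw [toAdd_mul, form_comm, qpow_form_add_left, map_mul, form_comm P x.toAdd,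
      form_comm P y.toAdd]

/-- The field `k(X)` of rational functions in the `X_b`, `b ∈ P`: the fraction field of `k[P]`. -/
abbrev RatX (k : Type*) [Field k] : Type _ := FractionRing (AddMonoidAlgebra k (weightLattice P))

instance : UniqueSums (weightLattice P) :=
  letI : Module ℚ M := Module.compHom M (algebraMap ℚ ℝ)
  UniqueSums.of_injective_addHom ((weightLattice P).subtype : weightLattice P →ₙ+ M)
    Subtype.val_injective inferInstance

instance (R : Type*) [CommRing R] [IsDomain R] :
    IsDomain (AddMonoidAlgebra R (weightLattice P)) :=
  NoZeroDivisors.to_isDomain _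

/-- `W` is finite, as it acts faithfully on the roots. -/
instance [P.IsRootSystem] : Finite P.weylGroup := by
  refine Finite.of_injective (fun w : P.weylGroup => (P.weylGroupToPerm w : ι → ι)) ?_
  intro u v huv
  refine Subtype.ext (RootPairing.Equiv.weightHom_injective P (LinearEquiv.toLinearMap_injective ?_))
  refine LinearMap.ext_on_range (v := P.root) (RootPairing.IsRootSystem.span_root_eq_top) fun i => ?_
  change u • P.root i = v • P.root i
  have := congrFun huv i
  rw [P.weylGroup_apply_root, P.weylGroup_apply_root]
  exact congrArg P.root this

instance [P.IsRootSystem] : Fintype P.weylGroup := Fintype.ofFinite _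

variable [P.IsCrystallographic]

/-- The action of `W` on the (multiplicatively written) weight lattice. -/
def weylOnLattice : P.weylGroup →* MulAut (Multiplicative (weightLattice P)) where
  toFun w := AddEquiv.toMultiplicative (DistribMulAction.toAddEquiv (weightLattice P) w)
  map_one' := by ext a; exact congrArg Subtype.val (one_smul P.weylGroup a.toAdd)
  map_mul' u v := by ext a; exact congrArg Subtype.val (mul_smul u v a.toAdd)

/-- The extended affine Weyl group `W ⋉ P`; the pair `⟨b, w⟩` is the product `b w`. -/
abbrev ExtAffineWeyl : Type _ :=
  Multiplicative (weightLattice P) ⋊[weylOnLattice P] P.weylGroup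

/-- A weight `b` as an element of the extended affine Weyl group. -/
def translation (b : weightLattice P) : ExtAffineWeyl P :=
  SemidirectProduct.inl (Multiplicative.ofAdd b)

/-- The action on `M × ℝ`: `w [z, ζ] = [w z, ζ]` and `b [z, ζ] = [z, ζ - (z, b)]`. -/
def affineAct (g : ExtAffineWeyl P) (z : M × ℝ) : M × ℝ :=
  (g.right • z.1, z.2 - form P (g.right • z.1) (g.left.toAdd : M))

/-- The reflection in the affine root `[α, ν_α j]`, where `α` is the root with index `i`:
it is the product `(-jα) s_α`. -/
def affineReflection (i : ι) (j : ℤ) : ExtAffineWeyl P :=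
  ⟨Multiplicative.ofAdd (-(j • rootWeight P i)), RootPairing.weylGroup.ofIdx P i⟩

section Field

variable (k : Type*) [Field k]

/-- The automorphisms of `k(X)` given by `w (X_a) = X_{w a}`. -/
def weylAut : P.weylGroup →* (RatX P k ≃+* RatX P k) :=
  (IsFractionRing.ringEquivOfRingEquivHom (AddMonoidAlgebra k (weightLattice P)) (RatX P k)).comp
    permute

variable [Algebra Kq k]

/-- `w Γ_b w⁻¹ = Γ_{w b}` on `k[P]`. -/
lemma permute_mul_twist (w : P.weylGroup) (c : Multiplicative (weightLattice P)) :
    permute w * twist (qchar P k c) =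
      twist (qchar P k (weylOnLattice P w c)) * permute (k := k) w := by
  refine RingEquiv.ext fun x => ?_
  induction x using AddMonoidAlgebra.induction_linear with
  | zero => simp
  | add f g hf hg => rw [map_add, map_add, hf, hg]
  | single a r =>
    change permute w (twist (qchar P k c) (AddMonoidAlgebra.single a r)) =
      twist (qchar P k (weylOnLattice P w c)) (permute w (AddMonoidAlgebra.single a r))
    rw [twist_single, permute_single, permute_single, twist_single]
    have : qpow P (form P (w • a : weightLattice P) (w • c.toAdd : weightLattice P)) =
        qpow P (form P a c.toAdd) := congrArg (qpow P) (form_smul_smul P w a c.toAdd)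
    congr 2
    exact congrArg (fun u : Kqˣ => (Units.map (algebraMap Kq k).toMonoidHom u : k)) this.symm

/-- The automorphism `Γ_b` of `k(X)`: `Γ_b (X_a) = q^{(a, b)} X_a`. -/
def shiftAut : Multiplicative (weightLattice P) →* (RatX P k ≃+* RatX P k) :=
  (IsFractionRing.ringEquivOfRingEquivHom (AddMonoidAlgebra k (weightLattice P)) (RatX P k)).comp
    (twist.comp (qchar P k))

/-- The action of the extended affine Weyl group on `k(X)`, where `b` acts as `Γ_{-b}`. -/
def extAffineAut : ExtAffineWeyl P →* (RatX P k ≃+* RatX P k) :=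
  SemidirectProduct.lift ((shiftAut P k).comp invMonoidHom) (weylAut P k) fun w => by
    refine MonoidHom.ext fun c => ?_
    have h := congrArg (IsFractionRing.ringEquivOfRingEquivHom
      (AddMonoidAlgebra k (weightLattice P)) (RatX P k)) (permute_mul_twist P k w c⁻¹)
    rw [map_mul, map_mul] at h
    change shiftAut P k (weylOnLattice P w c)⁻¹ =
      weylAut P k w * shiftAut P k c⁻¹ * (weylAut P k w)⁻¹
    rw [eq_mul_inv_iff_mul_eq, ← map_inv]
    exact h.symm

instance : MulSemiringAction (ExtAffineWeyl P) (RatX P k) :=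
  MulSemiringAction.compHom (RatX P k) (extAffineAut P k)

/-- The monomial `c X_a` in `k(X)`. -/
def mono {k : Type*} [Field k] (a : weightLattice P) (c : k) : RatX P k :=
  algebraMap (AddMonoidAlgebra k (weightLattice P)) (RatX P k) (AddMonoidAlgebra.single a c)

lemma mono_mul_mono (a a' : weightLattice P) (c c' : k) :
    mono P a c * mono P a' c' = mono P (a + a') (c * c') := by
  rw [mono, mono, mono, ← map_mul, AddMonoidAlgebra.single_mul_single]

lemma mono_zero_one : mono P 0 (1 : k) = 1 := by
  rw [mono, ← AddMonoidAlgebra.one_def, map_one]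

lemma mono_injective {a a' : weightLattice P} {c c' : k} (h : mono P a c = mono P a' c')
    (hc : c ≠ 0) : a = a' := by
  have h1 := IsFractionRing.injective (AddMonoidAlgebra k (weightLattice P)) (RatX P k) h
  rw [AddMonoidAlgebra.single_inj] at h1
  rcases h1 with h1 | h1
  · exact h1.1
  · exact absurd h1.1 hc

lemma mono_ne_zero (a : weightLattice P) {c : k} (hc : c ≠ 0) : mono P a c ≠ 0 := by
  rw [mono, Ne, IsFractionRing.to_map_eq_zero_iff]
  exact fun h => hc (by simpa using h)

lemma shiftAut_mono (c : Multiplicative (weightLattice P)) (a : weightLattice P) (r : k) :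
    shiftAut P k c (mono P a r) =
      mono P a ((qchar P k c (Multiplicative.ofAdd a) : k) * r) := by
  have h := IsFractionRing.ringEquivOfRingEquiv_algebraMap (K := RatX P k) (L := RatX P k)
    (twist (qchar P k c)) (AddMonoidAlgebra.single a r)
  rw [twist_single] at h
  exact h

lemma weylAut_mono (w : P.weylGroup) (a : weightLattice P) (r : k) :
    weylAut P k w (mono P a r) = mono P (w • a) r := by
  have h := IsFractionRing.ringEquivOfRingEquiv_algebraMap (K := RatX P k) (L := RatX P k)
    (permute w) (AddMonoidAlgebra.single a r)
  rw [permute_single] at h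
  exact h

lemma smul_mono (g : ExtAffineWeyl P) (a : weightLattice P) (c : k) :
    g • mono P a c = mono P (g.right • a)
      ((qchar P k g.left⁻¹ (Multiplicative.ofAdd (g.right • a)) : k) * c) := by
  have h : ∀ f : RatX P k, g • f = shiftAut P k g.left⁻¹ (weylAut P k g.right f) := fun _ => rfl
  rw [h, weylAut_mono, shiftAut_mono]

/-- The variable `X_{[α, ν_α j]} = q^{ν_α j} X_α` of an affine root. -/
def affineX (i : ι) (j : ℤ) : RatX P k :=
  mono P (rootWeight P i) (algebraMap Kq k (qpow P (nu P i * j)))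

lemma ofIdx_smul_rootWeight (i : ι) :
    RootPairing.weylGroup.ofIdx P i • rootWeight P i = -rootWeight P i := by
  refine Subtype.ext ?_
  change RootPairing.weylGroup.ofIdx P i • P.root i = -P.root i
  rw [RootPairing.weylGroup.ofIdx_smul, RootPairing.Equiv.reflection_smul, P.reflection_apply_self]

lemma ofIdx_mul_self (i : ι) :
    RootPairing.weylGroup.ofIdx P i * RootPairing.weylGroup.ofIdx P i = 1 := by
  refine Subtype.ext (RootPairing.Equiv.weightHom_injective P
    (LinearEquiv.toLinearMap_injective (LinearMap.ext fun x => ?_)))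
  change (RootPairing.weylGroup.ofIdx P i * RootPairing.weylGroup.ofIdx P i) • x = x
  rw [mul_smul, RootPairing.weylGroup.ofIdx_smul, RootPairing.weylGroup.ofIdx_smul,
    RootPairing.Equiv.reflection_smul, RootPairing.Equiv.reflection_smul,
    P.reflection_same]

lemma affineReflection_mul_self (i : ι) (j : ℤ) :
    affineReflection P i j * affineReflection P i j = 1 := by
  refine SemidirectProduct.ext ?_ (ofIdx_mul_self P i)
  change Multiplicative.ofAdd (-(j • rootWeight P i) +
    RootPairing.weylGroup.ofIdx P i • (-(j • rootWeight P i))) = Multiplicative.ofAdd 0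
  rw [smul_neg, smul_comm, ofIdx_smul_rootWeight]
  simp

lemma qpow_eq {x : ℝ} {z : ℤ} (hx : 2 * denom P * x = z) :
    qpow P x = (Units.mk0 (RatFunc.X : Kq) RatFunc.X_ne_zero) ^ z := by
  rw [qpow, hx, Int.floor_intCast]

lemma affineReflection_smul_affineX (i : ι) (j : ℤ) :
    affineReflection P i j • affineX P k i j = (affineX P k i j)⁻¹ := by
  obtain ⟨z, hz⟩ := (denom_spec P).2 (rootWeight P i) (rootWeight P i)
  have hz' : denom P * form P (P.root i) (P.root i) = z := hz
  refine eq_inv_of_mul_eq_one_left ?_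
  rw [affineX, smul_mono, mono_mul_mono]
  have e1 : qpow P (nu P i * j) = Units.mk0 (RatFunc.X : Kq) RatFunc.X_ne_zero ^ (z * j) := by
    refine qpow_eq P ?_
    push_cast
    rw [nu, ← hz']
    ring
  have e2 : qpow P (form P ((-rootWeight P i : weightLattice P) : M)
      ((j • rootWeight P i : weightLattice P) : M)) =
      Units.mk0 (RatFunc.X : Kq) RatFunc.X_ne_zero ^ (-(2 * z * j)) := by
    refine qpow_eq P ?_
    have : form P ((-rootWeight P i : weightLattice P) : M)
        ((j • rootWeight P i : weightLattice P) : M) = -(j * form P (P.root i) (P.root i)) := by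
      rw [AddSubgroup.coe_neg, AddSubgroup.coe_zsmul]
      change form P (-P.root i) (j • P.root i) = _
      rw [form, form, map_neg, LinearMap.neg_apply, ← Int.cast_smul_eq_zsmul ℝ, map_smul,
        smul_eq_mul]
      ring
    rw [this]
    push_cast
    rw [← hz']
    ring
  have e3 : ((qchar P k (affineReflection P i j).left⁻¹
      (Multiplicative.ofAdd ((affineReflection P i j).right • rootWeight P i)) : kˣ) : k) =
      algebraMap Kq k (qpow P (form P ((-rootWeight P i : weightLattice P) : M)
        ((j • rootWeight P i : weightLattice P) : M))) := by
    have h1 : (affineReflection P i j).right • rootWeight P i = -rootWeight P i :=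
      ofIdx_smul_rootWeight P i
    have h2 : (affineReflection P i j).left⁻¹ = Multiplicative.ofAdd (j • rootWeight P i) := by
      change Multiplicative.ofAdd (- -(j • rootWeight P i)) = _
      rw [neg_neg]
    rw [h1, h2]
    rfl
  have h1 : (affineReflection P i j).right • rootWeight P i = -rootWeight P i :=
    ofIdx_smul_rootWeight P i
  rw [e3, h1, e2, e1, neg_add_cancel, ← map_mul, ← map_mul, ← Units.val_mul, ← Units.val_mul,
    ← zpow_add, ← zpow_add, ← mono_zero_one]
  congr 1
  rw [show -(2 * z * j) + z * j + z * j = 0 by ring]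
  simp

lemma affineX_ne_one (i : ι) (j : ℤ) : affineX P k i j ≠ 1 := by
  intro h
  rw [affineX, ← mono_zero_one] at h
  have := mono_injective P k h (by simp)
  exact P.ne_zero i (congrArg Subtype.val this)

lemma smul_mono_zero (g : ExtAffineWeyl P) (c : k) : g • mono P 0 c = mono P 0 c := by
  rw [smul_mono, smul_zero]
  simp

end Field

/-! ## Fundamental weights and the maximal short root -/

lemma nonempty_index [P.IsRootSystem] [P.IsIrreducible] : Nonempty ι := by
  by_contra h
  rw [not_nonempty_iff] at h
  have h1 := RootPairing.IsRootSystem.span_root_eq_top (P := P)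
  rw [Set.range_eq_empty, Submodule.span_empty] at h1
  have := RootPairing.IsIrreducible.nontrivial (P := P)
  exact bot_ne_top h1

lemma exists_isShort [P.IsRootSystem] [P.IsIrreducible] : ∃ i, IsShort P i := by
  have := nonempty_index P
  obtain ⟨i, hi⟩ := exists_eq_ciInf_of_finite (f := fun i => P.RootForm (P.root i) (P.root i))
  refine ⟨i, ?_⟩
  have hpos : (0 : ℝ) < P.RootForm (P.root i) (P.root i) := by
    rw [P.rootForm_root_self]
    exact Finset.sum_pos' (fun j _ => mul_self_nonneg _) ⟨i, Finset.mem_univ _, by simp⟩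
  rw [IsShort, nu, form, ← hi]
  field_simp

section Base

variable {P} [P.IsRootSystem] (b : P.Base)

/-- Fundamental weights: `(ω_i, α_j^∨) = δ_{ij}` for the simple roots `α_j`. -/
def fundamentalWeight (i : b.support) : weightLattice P :=
  ⟨P.toLinearMap.toPerfPair.symm (b.toCoweightBasis.coord i), fun j => by
    classical
    rw [LinearMap.apply_symm_toPerfPair_self]
    have h := b.coroot_mem_span_int j
    generalize P.coroot j = y at h ⊢
    induction h using Submodule.span_induction with
    | mem x hx =>
      obtain ⟨l, hl, rfl⟩ := hx
      have e : P.coroot l = b.toCoweightBasis ⟨l, hl⟩ := (b.toCoweightBasis_apply ⟨l, hl⟩).symm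
      rw [e, Module.Basis.coord_apply, Module.Basis.repr_self, Finsupp.single_apply]
      split_ifs
      · exact ⟨1, by simp⟩
      · exact ⟨0, by simp⟩
    | zero => exact ⟨0, by simp⟩
    | add x y _ _ hx hy =>
      obtain ⟨m, hm⟩ := hx
      obtain ⟨n, hn⟩ := hy
      exact ⟨m + n, by simp only [map_add, hm, hn, Int.cast_add]⟩
    | smul a x _ hx =>
      obtain ⟨m, hm⟩ := hx
      exact ⟨a * m, by simp only [map_zsmul, hm, zsmul_eq_mul, Int.cast_mul]⟩⟩

/-- `ω_i` is minuscule: `(ω_i, α^∨) ≤ 1` for all positive roots `α`. -/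
def IsMinuscule (i : b.support) : Prop :=
  ∀ j, b.IsPos j → pair P (fundamentalWeight b i) j ≤ 1

lemma exists_maxShort [P.IsIrreducible] :
    ∃ i, IsShort P i ∧ ∀ j, IsShort P j → b.height j ≤ b.height i := by
  classical
  obtain ⟨i₀, hi₀⟩ := exists_isShort P
  obtain ⟨i, hi, h⟩ := Finset.exists_max_image (Finset.univ.filter fun i => IsShort P i) b.height
    ⟨i₀, by simpa using hi₀⟩
  exact ⟨i, by simpa using hi, fun j hj => h j (by simpa using hj)⟩

/-- The maximal short root `ϑ` (its index). -/
def maxShort [P.IsIrreducible] : ι := (exists_maxShort b).choose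

/-! ## The extended affine Weyl group: simple reflections, `Π`, reduced decompositions -/

variable [P.IsIrreducible]

/-- The affine simple roots, as pairs (root `α`, integer `j`) standing for `[α, ν_α j]`:
`α_0 = [-ϑ, 1]` for `none` and `α_i = [α_i, 0]` for `some i`. -/
def affineSimple : Option b.support → ι × ℤ
  | none => (P.reflectionPerm (maxShort b) (maxShort b), 1)
  | some i => (i, 0)

/-- The simple reflections `s_0, s_1, …, s_n`. -/
def simpleReflection (i : Option b.support) : ExtAffineWeyl P :=
  affineReflection P (affineSimple b i).1 (affineSimple b i).2

/-- The vector `[α, ν_α j]` of an affine simple root. -/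
def affineSimpleVec (i : Option b.support) : M × ℝ :=
  (P.root (affineSimple b i).1, nu P (affineSimple b i).1 * (affineSimple b i).2)

/-- The elements of the group `Π`: they permute the affine simple roots. -/
def IsDiagramAut (g : ExtAffineWeyl P) : Prop :=
  affineAct P g '' Set.range (affineSimpleVec b) = Set.range (affineSimpleVec b)

/-- `g = π s_{i_1} ⋯ s_{i_l}` with `π ∈ Π` and `L = [i_1, …, i_l]`. -/
def IsExpression (g π : ExtAffineWeyl P) (L : List (Option b.support)) : Prop :=
  IsDiagramAut b π ∧ g = π * (L.map (simpleReflection b)).prod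

/-- Reduced decompositions `g = π s_{i_1} ⋯ s_{i_l}`: the number `l` is the least possible. -/
def IsReducedExpression (g π : ExtAffineWeyl P) (L : List (Option b.support)) : Prop :=
  IsExpression b g π L ∧ ∀ π' L', IsExpression b g π' L' → L.length ≤ L'.length

end Base

/-! ## The parameters `t` and the difference Dunkl operators -/

section Operators

/-- The set of values of `ν_α`. -/
abbrev nuSet : Set ℝ := Set.range (nu P)

/-- The field `ℚ(q^{1/(2m)}, t_ν^{1/2})`; the variable with index `ν` is `t_ν^{1/2}`. -/
abbrev Kqt : Type := FractionRing (MvPolynomial (nuSet P) Kq)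

/-- `t_α^{1/2} = t_ν^{1/2}` for `ν = ν_α`. -/
def sqrtT (i : ι) : (Kqt P)ˣ :=
  Units.mk0 (algebraMap (MvPolynomial (nuSet P) Kq) (Kqt P) (MvPolynomial.X ⟨nu P i, i, rfl⟩))
    (by
      rw [Ne, IsFractionRing.to_map_eq_zero_iff]
      exact MvPolynomial.X_ne_zero _)

/-- The algebra of difference-reflection operators `∑ g_{b,w} Γ_b w` with coefficients `g_{b,w}`
in the field of rational functions of the `X_a`: the skew group algebra of the extended affine
Weyl group, whose element `⟨b, w⟩` is the operator `Γ_{-b} w`. -/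
abbrev DiffRefl : Type _ := SkewMonoidAlgebra (RatX P (Kqt P)) (ExtAffineWeyl P)

end Operators

section DemazureLusztig

variable {K G : Type*} [Field K] [Group G] [MulSemiringAction G K]

/-- `τ s + (τ - τ⁻¹) (X - 1)⁻¹ (s - 1)`. -/
def demazureLusztigVal (s : G) (X τ : K) : SkewMonoidAlgebra K G :=
  SkewMonoidAlgebra.single s τ +
    SkewMonoidAlgebra.single 1 ((τ - τ⁻¹) * (X - 1)⁻¹) * (SkewMonoidAlgebra.single s 1 - 1)

lemma demazureLusztigVal_eq (s : G) (X τ : K) : demazureLusztigVal s X τ =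
    SkewMonoidAlgebra.single s (τ + (τ - τ⁻¹) * (X - 1)⁻¹) +
      SkewMonoidAlgebra.single 1 (-((τ - τ⁻¹) * (X - 1)⁻¹)) := by
  rw [demazureLusztigVal, mul_sub, mul_one, SkewMonoidAlgebra.single_mul_single, smul_one, mul_one,
    one_mul, SkewMonoidAlgebra.single_add, SkewMonoidAlgebra.single_neg]
  abel

lemma demazureLusztig_quadratic {s : G} {X τ : K} (hs : s * s = 1) (hX : s • X = X⁻¹)
    (hX1 : X ≠ 1) (hX0 : X ≠ 0) (hτ : s • τ = τ) (hτ0 : τ ≠ 0) :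
    demazureLusztigVal s X τ * demazureLusztigVal s X τ =
      SkewMonoidAlgebra.single 1 (τ - τ⁻¹) * demazureLusztigVal s X τ + 1 := by
  have h1 : X - 1 ≠ 0 := sub_ne_zero.2 hX1
  have h2 : X⁻¹ - 1 ≠ 0 := sub_ne_zero.2 (by simpa using hX1)
  have h3 : (X⁻¹ - 1)⁻¹ = -X * (X - 1)⁻¹ := by
    field_simp
    ring
  have hτ' : s • τ⁻¹ = τ⁻¹ := by rw [smul_inv'', hτ]
  have hXs : s • (X - 1)⁻¹ = -X * (X - 1)⁻¹ := by
    rw [smul_inv'', smul_sub, hX, smul_one, h3]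
  set a := (τ - τ⁻¹) * (X - 1)⁻¹ with ha
  have ha' : s • a = -(τ - τ⁻¹) - a := by
    rw [ha, smul_mul', smul_sub, hτ, hτ', hXs]
    field_simp
    ring
  have hd : τ * τ⁻¹ = 1 := mul_inv_cancel₀ hτ0
  rw [demazureLusztigVal_eq, ← ha, mul_add, mul_add, add_mul, add_mul]
  simp only [SkewMonoidAlgebra.single_mul_single, SkewMonoidAlgebra.one_def, hs, mul_one, one_mul,
    one_smul, smul_add, smul_neg, ha', hτ]
  have e1 : (τ + a) * (τ + (-(τ - τ⁻¹) - a)) = 1 - a * a + (τ⁻¹ - τ) * a := by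
    linear_combination hd
  rw [e1]
  have e2 : (τ + a) * -(-(τ - τ⁻¹) - a) = (τ - τ⁻¹) * (τ + a) - (-a * (τ + a)) := by ring
  have e3 : (τ⁻¹ - τ) * a = (τ - τ⁻¹) * -a := by ring
  have e4 : ∀ x y : K, SkewMonoidAlgebra.single s (x - y) =
      SkewMonoidAlgebra.single s x - SkewMonoidAlgebra.single s y := fun x y => by
    rw [sub_eq_add_neg, SkewMonoidAlgebra.single_add, SkewMonoidAlgebra.single_neg, sub_eq_add_neg]
  have e5 : ∀ x y : K, SkewMonoidAlgebra.single (1 : G) (x - y) =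
      SkewMonoidAlgebra.single 1 x - SkewMonoidAlgebra.single 1 y := fun x y => by
    rw [sub_eq_add_neg, SkewMonoidAlgebra.single_add, SkewMonoidAlgebra.single_neg, sub_eq_add_neg]
  rw [e2, e3, SkewMonoidAlgebra.single_add, e4, e5, neg_mul_neg]
  abel

/-- The operator `τ s + (τ - τ⁻¹) (X - 1)⁻¹ (s - 1)` as an invertible operator. -/
def demazureLusztig (s : G) (X τ : K) (hs : s * s = 1) (hX : s • X = X⁻¹)
    (hX1 : X ≠ 1) (hτ : s • τ = τ) (hτ0 : τ ≠ 0) (hX0 : X ≠ 0) : (SkewMonoidAlgebra K G)ˣ where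
  val := demazureLusztigVal s X τ
  inv := demazureLusztigVal s X τ - SkewMonoidAlgebra.single 1 (τ - τ⁻¹)
  val_inv := by
    have hc : demazureLusztigVal s X τ * SkewMonoidAlgebra.single 1 (τ - τ⁻¹) =
        SkewMonoidAlgebra.single 1 (τ - τ⁻¹) * demazureLusztigVal s X τ := by
      have hτ' : s • τ⁻¹ = τ⁻¹ := by rw [smul_inv'', hτ]
      rw [demazureLusztigVal_eq, add_mul, mul_add]
      simp only [SkewMonoidAlgebra.single_mul_single, mul_one, one_mul, one_smul, smul_sub, hτ, hτ']
      rw [mul_comm, mul_comm (-_)]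
    rw [mul_sub, demazureLusztig_quadratic hs hX hX1 hX0 hτ hτ0, hc]
    abel
  inv_val := by
    rw [sub_mul, demazureLusztig_quadratic hs hX hX1 hX0 hτ hτ0]
    abel

end DemazureLusztig

section DunklOperators

variable {P} [P.IsRootSystem] [P.IsIrreducible] (b : P.Base)

/-- `T_i = t_i^{1/2} s_i + (t_i^{1/2} - t_i^{-1/2}) (X_{α_i} - 1)⁻¹ (s_i - 1)` for
`i = 0, 1, …, n`, where `X_{α_0} = q X_ϑ^{-1}`. -/
def simpleT (i : Option b.support) : (DiffRefl P)ˣ :=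
  demazureLusztig (simpleReflection b i)
    (affineX P (Kqt P) (affineSimple b i).1 (affineSimple b i).2)
    (mono P 0 (sqrtT P (affineSimple b i).1 : Kqt P))
    (affineReflection_mul_self P _ _) (affineReflection_smul_affineX P (Kqt P) _ _)
    (affineX_ne_one P (Kqt P) _ _) (smul_mono_zero P (Kqt P) _ _)
    (mono_ne_zero P (Kqt P) _ (Units.ne_zero _))
    (mono_ne_zero P (Kqt P) _ (by simp))

/-- An element of the extended affine Weyl group as an invertible operator. -/
def groupUnit (g : ExtAffineWeyl P) : (DiffRefl P)ˣ where
  val := SkewMonoidAlgebra.single g 1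
  inv := SkewMonoidAlgebra.single g⁻¹ 1
  val_inv := by
    rw [SkewMonoidAlgebra.single_mul_single, smul_one, mul_one, mul_inv_cancel,
      SkewMonoidAlgebra.one_def]
  inv_val := by
    rw [SkewMonoidAlgebra.single_mul_single, smul_one, mul_one, inv_mul_cancel,
      SkewMonoidAlgebra.one_def]

/-- `T_g = π T_{i_1} ⋯ T_{i_l}` for a reduced decomposition `g = π s_{i_1} ⋯ s_{i_l}`.
Reduced decompositions exist for all `g`, and by the homogeneous Coxeter relations for the `T_i`
the result does not depend on the choice. -/
def heckeT (g : ExtAffineWeyl P) : (DiffRefl P)ˣ :=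
  open scoped Classical in
  if h : ∃ p : ExtAffineWeyl P × List (Option b.support), IsReducedExpression b g p.1 p.2 then
    groupUnit h.choose.1 * (h.choose.2.map (simpleT b)).prod
  else 1

/-- The difference Dunkl operators `Y_β = ∏ Y_i^{l_i}` for `β = ∑ l_i ω_i`, where
`Y_i = T_{ω_i}`, `l_i = (β, α_i^∨)`; the `Y_i` commute. -/
def dunklY (β : weightLattice P) : (DiffRefl P)ˣ :=
  ((Finset.univ : Finset b.support).toList.map fun i =>
    heckeT b (translation P (fundamentalWeight b i)) ^ pair P β i).prod

end DunklOperators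

/-! ## Spinors and the limit -/

section Spinors

variable (k : Type*) [Field k] [Algebra Kq k] [P.IsRootSystem]

/-- The algebra of functions-spinors `f = ∑_u f_u ζ_u`, `u ∈ W`, with pointwise operations;
`ζ_u` is the `u`-th coordinate idempotent. -/
def Spinor : Type _ := P.weylGroup → RatX P k

instance : CommRing (Spinor P k) := inferInstanceAs (CommRing (P.weylGroup → RatX P k))

/-- `Γ_c` acts on the components of a spinor, and `δ(v)` permutes them:
`(δ(v) f)_u = f_{v⁻¹ u}`. -/
instance : MulSemiringAction (Multiplicative (weightLattice P) × P.weylGroup) (Spinor P k) where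
  smul g f := fun u => shiftAut P k g.1 (f (g.2⁻¹ * u))
  one_smul f := funext fun u => by
    change shiftAut P k 1 (f (1⁻¹ * u)) = f u
    rw [map_one, inv_one, one_mul]
    rfl
  mul_smul g h f := funext fun u => by
    change shiftAut P k (g.1 * h.1) (f ((g.2 * h.2)⁻¹ * u)) =
      shiftAut P k g.1 (shiftAut P k h.1 (f (h.2⁻¹ * (g.2⁻¹ * u))))
    rw [map_mul, mul_inv_rev, mul_assoc]
    rfl
  smul_zero g := funext fun u => map_zero (shiftAut P k g.1)
  smul_add g x y := funext fun u => map_add (shiftAut P k g.1) _ _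
  smul_one g := funext fun u => map_one (shiftAut P k g.1)
  smul_mul g x y := funext fun u => map_mul (shiftAut P k g.1) _ _

/-- The algebra of difference-spin operators `∑ f_{c,v} Γ_c δ(v)` with spinor coefficients,
where the shift `Γ_c` acts diagonally (in the same way on all components). -/
abbrev SpinOp : Type _ :=
  SkewMonoidAlgebra (Spinor P k) (Multiplicative (weightLattice P) × P.weylGroup)

/-- The map `ϱ(f) = ∑_u u⁻¹(f) ζ_u` from functions to spinors. -/
def spinorOf (f : RatX P k) : Spinor P k := fun u => weylAut P k u⁻¹ f

open scoped Classical in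
/-- The idempotent `ζ_u`. -/
def zeta (u : P.weylGroup) : Spinor P k := fun v => if v = u then 1 else 0

/-- `ϱ(Γ_c) = ∑_u Γ_{u⁻¹ c} ζ_u`. -/
def spinorShift (c : weightLattice P) : SpinOp P k :=
  ∑ u : P.weylGroup,
    SkewMonoidAlgebra.single (Multiplicative.ofAdd (u⁻¹ • c), 1) (1 : Spinor P k) *
      SkewMonoidAlgebra.single 1 (zeta P k u)

/-- The map `f Γ_c w ↦ ϱ(f) ϱ(Γ_c) δ(w)` from difference-reflection operators to difference-spin
operators. Recall that `⟨b, w⟩` in the extended affine Weyl group is the operator `Γ_{-b} w`. -/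
def toSpin (A : SkewMonoidAlgebra (RatX P k) (ExtAffineWeyl P)) : SpinOp P k :=
  A.sum fun g f => SkewMonoidAlgebra.single 1 (spinorOf P k f) *
    spinorShift P k (-g.left.toAdd) * SkewMonoidAlgebra.single (1, g.right) 1

variable {P} in
/-- `q^{(ρ_k, a)} = ∏_{α > 0} t_α^{(a, α^∨) / 2} = ∏_ν t_ν^{(ρ_ν^∨, a)}`, as a character of the
weight lattice. -/
def rhoChar (b : P.Base) : Multiplicative (weightLattice P) →* (Kqt P)ˣ :=
  open scoped Classical in
  { toFun := fun a => ∏ i with b.IsPos i, sqrtT P i ^ pair P a.toAdd i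
    map_one' := Finset.prod_eq_one fun i _ => by
      have h := pair_add P 0 0 i
      rw [add_zero] at h
      rw [toAdd_one, show pair P 0 i = 0 by omega, zpow_zero]
    map_mul' := fun x y => by
      rw [← Finset.prod_mul_distrib]
      exact Finset.prod_congr rfl fun i _ => by rw [toAdd_mul, pair_add, zpow_add] }

variable {P} in
/-- The automorphism `X_a ↦ q^{-(ρ_k, a)} X_a` of the field of rational functions. -/
def rhoTwist (b : P.Base) : RatX P (Kqt P) ≃+* RatX P (Kqt P) :=
  IsFractionRing.ringEquivOfRingEquivHom _ _ (twist (rhoChar b)⁻¹)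

variable {P} in
/-- The conjugation of a difference-spin operator by `δ(X_{ρ_k} Γ_{-ρ_k})`: it multiplies each `X_a`
and each `Γ_a` by `q^{-(ρ_k, a)}`, and fixes the `δ(w)` and the `ζ_u`. -/
def rhoConj (b : P.Base) (A : SpinOp P (Kqt P)) : SpinOp P (Kqt P) :=
  A.sum fun g f => SkewMonoidAlgebra.single g fun u =>
    mono P 0 ((rhoChar b g.1)⁻¹ : (Kqt P)ˣ).val * rhoTwist b (f u)

/-- The element of the field of rational functions represented by a polynomial in the `X_a` with
coefficients that are polynomials in the `t_ν^{1/2}`. -/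
def genericValue (n : AddMonoidAlgebra (MvPolynomial (nuSet P) Kq) (weightLattice P)) :
    RatX P (Kqt P) :=
  algebraMap (AddMonoidAlgebra (Kqt P) (weightLattice P)) (RatX P (Kqt P))
    (AddMonoidAlgebra.mapRingHom (weightLattice P)
      (algebraMap (MvPolynomial (nuSet P) Kq) (Kqt P)) n)

/-- The value of such a polynomial at the point where all `t_ν^{1/2}` are zero. -/
def zeroValue (n : AddMonoidAlgebra (MvPolynomial (nuSet P) Kq) (weightLattice P)) :
    RatX P Kq :=
  algebraMap (AddMonoidAlgebra Kq (weightLattice P)) (RatX P Kq)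
    (AddMonoidAlgebra.mapRingHom (weightLattice P) MvPolynomial.constantCoeff n)

/-- The limit of `f` as `t_ν → 0` for all `ν` exists and is `g`: `f` is regular at the point where
all `t_ν^{1/2}` are zero, and `g` is its value there. -/
def IsLimit (f : RatX P (Kqt P)) (g : RatX P Kq) : Prop :=
  ∃ n d : AddMonoidAlgebra (MvPolynomial (nuSet P) Kq) (weightLattice P),
    zeroValue P d ≠ 0 ∧ f = genericValue P n / genericValue P d ∧
      g = zeroValue P n / zeroValue P d

variable {P} in
/-- `L = RE^δ(A)`: the operator `L` is the limit of `δ(X_{ρ_k} Γ_{-ρ_k}) A δ(X_{ρ_k} Γ_{-ρ_k})⁻¹`,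
where `A` is considered as a difference-spin operator, as `t_ν → 0` for all `ν`; the limit is taken
coefficient by coefficient. -/
def IsRE (b : P.Base) (A : DiffRefl P) (L : SpinOp P Kq) : Prop :=
  ∀ (g : Multiplicative (weightLattice P) × P.weylGroup) (u : P.weylGroup),
    IsLimit P ((rhoConj b (toSpin P (Kqt P) A)).coeff g u) (L.coeff g u)

end Spinors

end Lattice

end TodaDunkl
end

/-! Indexing spinor components by W turns an operator into a matrix: a term f g whose finite part is
w maps component v = w⁻¹u to component u, and after the conjugation its coefficient is `spinCoeff`.
Call an operator regular if all these coefficients are regular at t^{1/2} = 0. Products of regular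
operators are regular (`IsRegularOp.mul`), since the shifts Γ_c involve only powers of q, and a
regular operator has a limit (`IsRegularOp.exists_isRE`). It is therefore enough that T_c and T_c⁻¹
are regular for every dominant weight c (`isRegularOp_heckeT`). Each Y_b is a product of integer
powers of the T_{ω_r}, so minuscule weights and short roots need no separate argument.

A single T_i has poles of order t_i^{-1/2}. They are controlled by I(u) = ∏ t_α^{1/2} over the
positive α with uα negative (`inversionMonomial`). Let L be a word in the simple reflections and w
the finite part of its product. The claim is that row u of the corresponding product of the T_i is
I(w⁻¹u)/I(u) times a regular function, whatever the column (`boundedBy_prod_simpleT`), and that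
column v of the inverse is I(v)/I(w⁻¹v) times a regular function (`boundedBy_prod_simpleT_inv`). An
element π of Π preserves the positive affine roots, so its own coefficient is a ratio of the same
kind (`rhoChar_of_affPos_iff`). A translation has trivial finite part, so for π times the word of a
translation these ratios cancel.

The claim goes by induction on the word. The s_i-term of T_i has the required order for every u
(`regularAt_spinCoeff_simpleReflection`). The scalar term contains (X_γ - 1)⁻¹ with X_γ rescaled by
q^{-(ρ_k, γ)}, where γ is u⁻¹ of the finite part of α_i. Its order is t_i^{-1/2} q^{(ρ_k, γ)} or
t_i^{-1/2} according to the sign of γ (`diagMonomial`), and comparing this with the ratios of I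
(`diagMonomial_row`, `diagMonomial_column`) needs w⁻¹ of the finite part of α_i, with w the finite
part of the remaining word, to be positive. For a reduced word of a dominant translation this always
holds (`IsReducedExpression.isPos`): the affine roots of the word are positive ones made negative by
the translation, which only lowers the integer part by (c, α^∨). -/

noncomputable section

set_option linter.unusedSectionVars false

namespace TodaDunkl

/-! ### Weyl group action on roots, the invariant form, heights -/

section Roots

variable {ι M N : Type*} [Fintype ι] [AddCommGroup M] [Module ℝ M] [AddCommGroup N] [Module ℝ N]
  (P : RootPairing ι ℝ M N)

/-- The permutation of the roots given by an element of the Weyl group. -/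
abbrev perm (w : P.weylGroup) : Equiv.Perm ι := P.weylGroupToPerm w

/-- The index of the root `-α`. -/
abbrev opp (i : ι) : ι := P.reflectionPerm i i

/-- The reflection `s_α` as an element of the Weyl group. -/
abbrev refl (i : ι) : P.weylGroup := RootPairing.weylGroup.ofIdx P i

variable {P}

lemma root_perm (w : P.weylGroup) (i : ι) : P.root (perm P w i) = w • P.root i :=
  (P.weylGroup_apply_root w i).symm

lemma root_opp (i : ι) : P.root (opp P i) = -P.root i := by
  rw [opp, P.root_reflectionPerm, P.reflection_apply_self]

lemma opp_opp (i : ι) : opp P (opp P i) = i := by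
  apply P.root.injective
  rw [root_opp, root_opp, neg_neg]

lemma refl_smul (i : ι) (x : M) :
    refl P i • x = x - P.toLinearMap x (P.coroot i) • P.root i := by
  rw [refl, RootPairing.weylGroup.ofIdx_smul, RootPairing.Equiv.reflection_smul,
    P.reflection_apply]
  rfl

lemma perm_refl (i : ι) : perm P (refl P i) = P.reflectionPerm i := by
  ext j
  apply P.root.injective
  rw [root_perm, P.root_reflectionPerm, RootPairing.weylGroup.ofIdx_smul,
    RootPairing.Equiv.reflection_smul]

lemma perm_mul (u v : P.weylGroup) (i : ι) : perm P (u * v) i = perm P u (perm P v i) := by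
  rw [perm, map_mul]; rfl

lemma perm_one (i : ι) : perm P 1 i = i := by
  rw [perm, map_one]; rfl

lemma perm_inv_perm (u : P.weylGroup) (i : ι) : perm P u⁻¹ (perm P u i) = i := by
  rw [← perm_mul, inv_mul_cancel, perm_one]

lemma perm_perm_inv (u : P.weylGroup) (i : ι) : perm P u (perm P u⁻¹ i) = i := by
  rw [← perm_mul, mul_inv_cancel, perm_one]

lemma perm_refl_self (i : ι) : perm P (refl P i) i = opp P i := by rw [perm_refl]

lemma perm_opp (w : P.weylGroup) (i : ι) : perm P w (opp P i) = opp P (perm P w i) := by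
  apply P.root.injective
  rw [root_perm, root_opp, root_opp, root_perm, smul_neg]

lemma weyl_ext {u v : P.weylGroup} (h : ∀ x : M, u • x = v • x) : u = v :=
  Subtype.ext (RootPairing.Equiv.weightHom_injective P
    (LinearEquiv.toLinearMap_injective (LinearMap.ext h)))

lemma smul_coroot_perm (w : P.weylGroup) (x : M) (i : ι) :
    P.toLinearMap (w • x) (P.coroot (perm P w i)) = P.toLinearMap x (P.coroot i) := by
  obtain ⟨w, hw⟩ := w
  induction hw using RootPairing.weylGroup.induction generalizing x i with
  | mem j =>
    change P.toLinearMap (refl P j • x) (P.coroot (perm P (refl P j) i)) = _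
    rw [perm_refl, P.coroot_reflectionPerm, refl_smul, P.coreflection_apply]
    simp only [map_sub, map_smul, LinearMap.sub_apply, LinearMap.smul_apply, smul_eq_mul]
    have h2 : P.toLinearMap (P.root j) (P.coroot j) = 2 := P.root_coroot_two j
    rw [h2]
    simp only [RootPairing.root']
    ring
  | one =>
    change P.toLinearMap ((1 : P.weylGroup) • x) (P.coroot (perm P (1 : P.weylGroup) i)) = _
    rw [perm_one, one_smul]
  | mul u v hu hv h1 h2 =>
    change P.toLinearMap (((⟨u, hu⟩ * ⟨v, hv⟩ : P.weylGroup)) • x)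
      (P.coroot (perm P (⟨u, hu⟩ * ⟨v, hv⟩ : P.weylGroup) i)) = _
    rw [mul_smul, perm_mul, h1, h2]

lemma refl_perm (w : P.weylGroup) (i : ι) :
    refl P (perm P w i) = w * refl P i * w⁻¹ := by
  refine weyl_ext fun x => ?_
  rw [mul_smul, mul_smul, refl_smul, refl_smul, smul_sub, smul_inv_smul, root_perm,
    ← smul_coroot_perm w (w⁻¹ • x) i, smul_inv_smul]
  congr 1
  exact (smul_comm w _ (P.root i)).symm

lemma refl_mul_self [P.IsCrystallographic] (i : ι) : refl P i * refl P i = 1 := ofIdx_mul_self P i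

lemma refl_inv [P.IsCrystallographic] (i : ι) : (refl P i)⁻¹ = refl P i :=
  inv_eq_of_mul_eq_one_left (refl_mul_self i)

lemma refl_opp [P.IsCrystallographic] (i : ι) : refl P (opp P i) = refl P i := by
  have := refl_perm (refl P i) i
  rw [perm_refl_self] at this
  rw [this, refl_mul_self, one_mul, refl_inv]

lemma nu_perm (w : P.weylGroup) (i : ι) : nu P (perm P w i) = nu P i := by
  rw [nu, nu, root_perm, form_smul_smul]

lemma nu_opp (i : ι) : nu P (opp P i) = nu P i := by
  rw [← perm_refl_self, nu_perm]

lemma isShort_perm (w : P.weylGroup) {i : ι} : IsShort P (perm P w i) ↔ IsShort P i := by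
  rw [IsShort, IsShort, nu_perm]

/-- Invariance under s_α gives (x, α) = (s_α x, -α) = -(x, α) + (x, α^∨)(α, α), and one solves for
(x, α). -/
lemma form_root (x : M) (i : ι) :
    form P x (P.root i) = nu P i * P.toLinearMap x (P.coroot i) := by
  have h := form_smul_smul P (refl P i) x (P.root i)
  rw [← root_perm, perm_refl_self, root_opp, refl_smul] at h
  have e : form P (x - P.toLinearMap x (P.coroot i) • P.root i) (-P.root i) =
      -form P x (P.root i) + P.toLinearMap x (P.coroot i) * form P (P.root i) (P.root i) := by
    simp only [form, map_sub, map_smul, map_neg, LinearMap.sub_apply, LinearMap.smul_apply,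
      smul_eq_mul]
    ring
  rw [e] at h
  rw [nu]
  linarith

lemma form_add_right (x y z : M) : form P x (y + z) = form P x y + form P x z := by
  simp only [form, map_add]; ring

lemma form_add_left (x y z : M) : form P (x + y) z = form P x z + form P y z := by
  simp only [form, map_add, LinearMap.add_apply]; ring

lemma form_smul_left (r : ℝ) (x z : M) : form P (r • x) z = r * form P x z := by
  simp only [form, map_smul, LinearMap.smul_apply, smul_eq_mul]; ring

lemma rootForm_root_pos (i : ι) : 0 < P.RootForm (P.root i) (P.root i) := by
  rw [P.rootForm_root_self]
  exact Finset.sum_pos' (fun j _ => mul_self_nonneg _) ⟨i, Finset.mem_univ _, by simp⟩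

lemma one_le_nu (i : ι) : 1 ≤ nu P i := by
  have : Nonempty ι := ⟨i⟩
  obtain ⟨j, hj⟩ := exists_eq_ciInf_of_finite (f := fun i => P.RootForm (P.root i) (P.root i))
  have h1 : P.RootForm (P.root j) (P.root j) ≤ P.RootForm (P.root i) (P.root i) := by
    rw [hj]
    exact ciInf_le (Set.finite_range _).bddBelow i
  have h2 := rootForm_root_pos (P := P) j
  rw [nu, form, ← hj, le_div_iff₀ two_pos, le_div_iff₀ h2]
  linarith

lemma nu_pos (i : ι) : 0 < nu P i := one_pos.trans_le (one_le_nu i)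

section Crystallographic

variable [P.IsCrystallographic]

lemma pair_eq_of_cast {x : weightLattice P} {i : ι} {z : ℤ}
    (h : P.toLinearMap (x : M) (P.coroot i) = z) : pair P x i = z := by
  rw [pair_spec] at h
  exact_mod_cast h

lemma pair_rootWeight (i j : ι) : pair P (rootWeight P i) j = P.pairingIn ℤ i j := by
  apply pair_eq_of_cast
  exact (P.algebraMap_pairingIn ℤ i j).symm

lemma pair_smul_perm (w : P.weylGroup) (x : weightLattice P) (i : ι) :
    pair P (w • x) (perm P w i) = pair P x i := by
  apply pair_eq_of_cast
  rw [← pair_spec]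
  exact smul_coroot_perm w x i

lemma pair_smul (w : P.weylGroup) (x : weightLattice P) (i : ι) :
    pair P (w • x) i = pair P x (perm P w⁻¹ i) := by
  rw [← pair_smul_perm w x, perm_perm_inv]

lemma pair_neg (x : weightLattice P) (i : ι) : pair P (-x) i = -pair P x i := by
  have h := pair_add P (-x) x i
  have h0 := pair_add P 0 0 i
  rw [neg_add_cancel] at h
  rw [add_zero] at h0
  omega

lemma pair_zero (i : ι) : pair P 0 i = 0 := by
  have h0 := pair_add P 0 0 i
  rw [add_zero] at h0
  omega

lemma pair_zsmul (n : ℤ) (x : weightLattice P) (i : ι) : pair P (n • x) i = n * pair P x i := by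
  apply pair_eq_of_cast
  rw [AddSubgroup.coe_zsmul, map_zsmul, LinearMap.smul_apply, pair_spec]
  simp

lemma pair_opp (x : weightLattice P) (i : ι) : pair P x (opp P i) = -pair P x i := by
  apply pair_eq_of_cast
  have h : P.coroot (opp P i) = -P.coroot i := by
    rw [opp, P.coroot_reflectionPerm, P.coreflection_apply_self]
  rw [h, map_neg, pair_spec]
  simp

lemma rootWeight_perm (w : P.weylGroup) (i : ι) :
    rootWeight P (perm P w i) = w • rootWeight P i :=
  Subtype.ext (root_perm w i)

lemma rootWeight_opp (i : ι) : rootWeight P (opp P i) = -rootWeight P i :=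
  Subtype.ext (root_opp i)

lemma root_reflectionPerm_eq (i j : ι) :
    P.root (P.reflectionPerm i j) = P.root j - P.pairingIn ℤ j i • P.root i := by
  rw [← perm_refl, root_perm, refl_smul, ← Int.cast_smul_eq_zsmul ℝ]
  congr 2
  exact (P.algebraMap_pairingIn ℤ j i).symm

lemma pairingIn_cast (i j : ι) : (P.pairingIn ℤ i j : ℝ) = P.toLinearMap (P.root i) (P.coroot j) :=
  P.algebraMap_pairingIn ℤ i j

lemma pairingIn_perm (w : P.weylGroup) (i j : ι) :
    P.pairingIn ℤ (perm P w i) (perm P w j) = P.pairingIn ℤ i j := by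
  rw [← pair_rootWeight, ← pair_rootWeight, rootWeight_perm, pair_smul_perm]

lemma pairingIn_opp_left (i j : ι) : P.pairingIn ℤ (opp P i) j = -P.pairingIn ℤ i j := by
  rw [← pair_rootWeight, ← pair_rootWeight, rootWeight_opp, pair_neg]

lemma pairingIn_reflectionPerm_right (i j : ι) :
    P.pairingIn ℤ i (P.reflectionPerm i j) = -P.pairingIn ℤ i j := by
  rw [← pairingIn_opp_left, ← pairingIn_perm (refl P i) (opp P i) j, perm_opp, perm_refl_self,
    opp_opp, perm_refl]

lemma nu_mul_pairingIn (i j : ι) :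
    nu P i * P.pairingIn ℤ j i = nu P j * P.pairingIn ℤ i j := by
  rw [pairingIn_cast, pairingIn_cast, ← form_root, ← form_root, form_comm]

/-- A short root `γ ≠ ±α` satisfies `|(γ, α^∨)| ≤ 1`. -/
lemma IsShort.abs_pairingIn_le [P.IsReduced] {i j : ι} (hi : IsShort P i) (h1 : i ≠ j)
    (h2 : i ≠ opp P j) : |P.pairingIn ℤ i j| ≤ 1 := by
  -- The possible pairs of Cartan integers form a finite list. Because ν_γ = 1 ≤ ν_α, the integer
  -- (γ, α^∨) is the smaller of the two in absolute value, which excludes ±2 and ±3.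
  have hm := P.pairingIn_pairingIn_mem_set_of_isCrystal_of_isRed' i j
    (fun h => h1 (P.root.injective h))
    (fun h => h2 (P.root.injective (by rw [h, root_opp])))
  have hn := nu_mul_pairingIn (P := P) i j
  rw [show nu P i = 1 from hi, one_mul] at hn
  have h3 := one_le_nu (P := P) j
  simp only [Set.mem_insert_iff, Set.mem_singleton_iff, Prod.mk.injEq] at hm
  rcases hm with h | h | h | h | h | h | h | h | h | h | h <;> rw [h.1, h.2] at hn <;>
    rw [h.1] <;> norm_num at hn ⊢ <;> linarith

end Crystallographic

section Base

variable (b : P.Base)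

lemma isPos_opp {i : ι} : b.IsPos (opp P i) ↔ ¬ b.IsPos i :=
  RootPairing.Base.IsPos.neg_iff_not b i

lemma height_opp (i : ι) : b.height (opp P i) = -b.height i := b.height_reflectionPerm_self i

/-- The height as a linear functional. -/
def heightForm [P.IsRootSystem] : M →ₗ[ℝ] ℝ := b.toWeightBasis.constr ℝ (fun _ => (1 : ℝ))

lemma heightForm_root [P.IsRootSystem] (i : ι) : heightForm b (P.root i) = b.height i := by
  obtain ⟨f, -, -, hf⟩ := b.exists_root_eq_sum_int i
  rw [RootPairing.Base.height_eq_sum hf, hf, map_sum]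
  push_cast
  refine Finset.sum_congr rfl fun j hj => ?_
  have : P.root j = b.toWeightBasis ⟨j, hj⟩ := (b.toWeightBasis_apply ⟨j, hj⟩).symm
  rw [map_zsmul, this, heightForm, Module.Basis.constr_basis]
  simp

variable [P.IsCrystallographic]

-- Coroots are not additive along sums of roots, but the form is. Hence the induction over sums of
-- simple roots is run for (x, α) and translated back to (x, α^∨) by the factor ν_α > 0.
variable {b} in
lemma nonneg_of_isPos {x : M} (hx : ∀ k ∈ b.support, 0 ≤ P.toLinearMap x (P.coroot k)) {j : ι}
    (hj : b.IsPos j) : 0 ≤ P.toLinearMap x (P.coroot j) := by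
  have key : 0 ≤ form P x (P.root j) := by
    refine hj.induction_on_add (p := fun j => 0 ≤ form P x (P.root j)) (fun i hi => ?_)
      (fun i k l hl h1 hk => ?_)
    · rw [form_root]
      exact mul_nonneg (nu_pos i).le (hx i hi)
    · rw [hl, form_add_right]
      refine add_nonneg h1 ?_
      rw [form_root]
      exact mul_nonneg (nu_pos k).le (hx k hk)
  rw [form_root] at key
  exact nonneg_of_mul_nonneg_right key (nu_pos j)

variable {b} in
lemma pairingIn_nonneg_of_isPos {i j : ι} (hi : ∀ k ∈ b.support, 0 ≤ P.pairingIn ℤ i k)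
    (hj : b.IsPos j) : 0 ≤ P.pairingIn ℤ i j := by
  have := nonneg_of_isPos (x := P.root i) (fun k hk => by
    rw [← pairingIn_cast]; exact_mod_cast hi k hk) hj
  rw [← pairingIn_cast] at this
  exact_mod_cast this

lemma height_reflectionPerm (i j : ι) :
    b.height (P.reflectionPerm i j) = b.height j - P.pairingIn ℤ j i * b.height i := by
  have h : P.root (P.reflectionPerm i j) = P.root j + (-P.pairingIn ℤ j i) • P.root i := by
    rw [root_reflectionPerm_eq, neg_smul, sub_eq_add_neg]
  rw [b.height_add_zsmul h, smul_eq_mul]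
  ring

variable {b} in
/-- A root of maximal height in a suitable set is dominant. -/
lemma dominant_of_height_max (S : ι → Prop) {i : ι} (hmax : ∀ j, S j → b.height j ≤ b.height i)
    (hS : ∀ k ∈ b.support, P.pairingIn ℤ i k < 0 → S (P.reflectionPerm k i)) :
    ∀ j, b.IsPos j → 0 ≤ P.pairingIn ℤ i j := by
  refine fun j hj => pairingIn_nonneg_of_isPos (fun k hk => ?_) hj
  by_contra! h
  -- Reflecting in a simple root with negative pairing would raise the height.
  have h1 := hmax _ (hS k hk h)
  rw [height_reflectionPerm, RootPairing.Base.height_one_of_mem_support hk] at h1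
  omega

variable [P.IsRootSystem] [P.IsIrreducible]

lemma isShort_maxShort : IsShort P (maxShort b) := (exists_maxShort b).choose_spec.1

lemma height_le_maxShort {j : ι} (hj : IsShort P j) : b.height j ≤ b.height (maxShort b) :=
  (exists_maxShort b).choose_spec.2 j hj

lemma maxShort_dominant {j : ι} (hj : b.IsPos j) : 0 ≤ P.pairingIn ℤ (maxShort b) j :=
  dominant_of_height_max (IsShort P) (fun _ => height_le_maxShort b)
    (fun k _ _ => by rw [← perm_refl, isShort_perm]; exact isShort_maxShort b) j hj

lemma isPos_maxShort : b.IsPos (maxShort b) := by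
  by_contra h
  have h1 := height_le_maxShort b (j := opp P (maxShort b))
    (by rw [← perm_refl_self, isShort_perm]; exact isShort_maxShort b)
  rw [height_opp] at h1
  rw [RootPairing.Base.isPos_iff'] at h
  omega

/-- By irreducibility the W-orbit of one short root spans the space, so it is not orthogonal to the
given root; a negative value is corrected by passing to the opposite root. -/
lemma exists_isShort_form_pos (i : ι) : ∃ j, IsShort P j ∧ 0 < form P (P.root i) (P.root j) := by
  obtain ⟨j₀, hj₀⟩ := exists_isShort P
  have h1 : ∃ w : P.weylGroup, form P (P.root i) (w • P.root j₀) ≠ 0 := by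
    by_contra! h
    have h2 : (⊤ : Submodule ℝ M) ≤ LinearMap.ker (P.RootForm (P.root i)) := by
      rw [← P.span_orbit_eq_top j₀, Submodule.span_le]
      rintro _ ⟨w, rfl⟩
      have := h w
      have hpos : 0 < nu P i := nu_pos i
      rw [SetLike.mem_coe, LinearMap.mem_ker]
      rw [form, div_eq_zero_iff] at this
      rcases this with h3 | h3
      · simpa using h3
      · rw [nu, form, h3] at hpos
        simp at hpos
    have h3 := h2 (Submodule.mem_top (x := P.root i))
    rw [LinearMap.mem_ker] at h3
    exact (rootForm_root_pos (P := P) i).ne' h3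
  obtain ⟨w, hw⟩ := h1
  rw [← root_perm] at hw
  rcases lt_or_gt_of_ne hw with h | h
  · refine ⟨opp P (perm P w j₀), ?_, ?_⟩
    · rw [← perm_opp, isShort_perm, ← perm_refl_self, isShort_perm]
      exact hj₀
    · rw [root_opp]
      have : form P (P.root i) (-P.root (perm P w j₀)) = -form P (P.root i) (P.root (perm P w j₀)) := by
        simp only [form, map_neg]; ring
      rw [this]
      linarith
  · exact ⟨_, (isShort_perm w).2 hj₀, h⟩

variable [P.IsReduced]

/-- Every root `α` satisfies `ht α ≤ ν_α ht ϑ`. -/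
lemma height_le_nu_mul (i : ι) : (b.height i : ℝ) ≤ nu P i * b.height (maxShort b) := by
  classical
  -- It suffices to treat the highest root a of the given length, which is dominant.
  obtain ⟨a, ha, hamax⟩ := Finset.exists_max_image (Finset.univ.filter fun j => nu P j = nu P i)
    b.height ⟨i, by simp⟩
  simp only [Finset.mem_filter, Finset.mem_univ, true_and] at ha hamax
  have hadom := dominant_of_height_max (b := b) (fun j => nu P j = nu P i) hamax
    (fun k _ _ => by rw [← perm_refl, nu_perm]; exact ha)
  obtain ⟨c₀, hc₀, hc₀'⟩ := exists_isShort_form_pos (P := P) a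
  -- The comparison root c is the highest short root with (a, c) > 0. A simple reflection that
  -- raises c keeps (a, c) > 0 because a is dominant, so c is dominant as well.
  obtain ⟨c, hc, hcmax⟩ := Finset.exists_max_image
    (Finset.univ.filter fun j => IsShort P j ∧ 0 < form P (P.root a) (P.root j))
    b.height ⟨c₀, by simp [hc₀, hc₀']⟩
  simp only [Finset.mem_filter, Finset.mem_univ, true_and] at hc hcmax
  have hcdom := dominant_of_height_max (b := b)
    (fun j => IsShort P j ∧ 0 < form P (P.root a) (P.root j)) hcmax (fun k hk hneg => by
      refine ⟨by rw [← perm_refl, isShort_perm]; exact hc.1, ?_⟩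
      have e : P.root (P.reflectionPerm k c) = P.root c + (-(P.pairingIn ℤ c k : ℝ)) • P.root k := by
        rw [root_reflectionPerm_eq, neg_smul, Int.cast_smul_eq_zsmul, sub_eq_add_neg]
      rw [e, form_add_right, form_comm P (P.root a) (_ • _), form_smul_left, form_comm P (P.root k),
        form_root (P.root a) k]
      have h1 := hadom k (RootPairing.Base.isPos_of_mem_support hk)
      have h1' : (0 : ℝ) ≤ P.pairingIn ℤ a k := by exact_mod_cast h1
      rw [← pairingIn_cast]
      have h2 : (0 : ℝ) < -(P.pairingIn ℤ c k : ℝ) := by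
        have : (P.pairingIn ℤ c k : ℝ) < 0 := by exact_mod_cast hneg
        linarith
      have h3 := mul_nonneg h2.le (mul_nonneg (nu_pos (P := P) k).le h1')
      have := hc.2
      linarith)
  have hle : b.height i ≤ b.height a := hamax i rfl
  have hcle : b.height c ≤ b.height (maxShort b) := height_le_maxShort b hc.1
  have hθ : 0 < b.height (maxShort b) := isPos_maxShort b
  have hle' : (b.height i : ℝ) ≤ b.height a := by exact_mod_cast hle
  have hcle' : (b.height c : ℝ) ≤ b.height (maxShort b) := by exact_mod_cast hcle
  refine hle'.trans ?_
  rw [← ha]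
  by_cases hac : c = a
  · subst hac
    rw [show nu P c = 1 from hc.1, one_mul]
    exact hcle'
  have hpos : (0 : ℝ) < P.pairingIn ℤ a c := by
    have := hc.2
    rw [form_root, ← pairingIn_cast] at this
    exact pos_of_mul_pos_right this (nu_pos (P := P) c).le
  have hn := nu_mul_pairingIn (P := P) c a
  rw [show nu P c = 1 from hc.1, one_mul] at hn
  have hpos' : (0 : ℝ) < P.pairingIn ℤ c a := by
    rw [hn] at hpos
    exact pos_of_mul_pos_right hpos (nu_pos (P := P) a).le
  have hpos'' : 0 < P.pairingIn ℤ c a := by exact_mod_cast hpos'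
  have hca : P.pairingIn ℤ c a = 1 := by
    by_cases hop : c = opp P a
    · exfalso
      have := hc.2
      rw [hop, root_opp] at this
      have e : form P (P.root a) (-P.root a) = -form P (P.root a) (P.root a) := by
        simp only [form, map_neg]; ring
      rw [e] at this
      have h2 := nu_pos (P := P) a
      rw [nu] at h2
      linarith
    · have := abs_le.1 (hc.1.abs_pairingIn_le hac hop)
      omega
  rw [hca, Int.cast_one, mul_one] at hn
  -- Here (c, a^∨) = 1 and (a, c^∨) = ν_a, so s_c(a) = a - ν_a c. It pairs to -1 with the dominant c
  -- and is therefore negative, which gives ht a ≤ ν_a ht c.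
  have hneg : ¬ b.IsPos (P.reflectionPerm c a) := by
    intro hp
    have h1 := hcdom _ hp
    rw [pairingIn_reflectionPerm_right] at h1
    omega
  rw [RootPairing.Base.isPos_iff', height_reflectionPerm] at hneg
  have h3 : (b.height a : ℝ) - P.pairingIn ℤ a c * b.height c ≤ 0 := by
    exact_mod_cast (not_le.1 hneg).le
  rw [hn] at h3
  have := mul_le_mul_of_nonneg_left hcle' (nu_pos (P := P) a).le
  linarith

end Base

end Roots

/-! ### Affine roots, exchange condition, reduced words of dominant translations -/

section AffineRoots

variable {ι M N : Type*} [Fintype ι] [AddCommGroup M] [Module ℝ M] [AddCommGroup N] [Module ℝ N]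
  {P : RootPairing ι ℝ M N} [P.IsCrystallographic]

/-- The action of the extended affine Weyl group on the affine roots `[α, ν_α j]`, written as pairs
`(α, j)`. -/
def affPerm (g : ExtAffineWeyl P) (v : ι × ℤ) : ι × ℤ :=
  (perm P g.right v.1, v.2 - pair P g.left.toAdd (perm P g.right v.1))

lemma affPerm_one (v : ι × ℤ) : affPerm (1 : ExtAffineWeyl P) v = v := by
  refine Prod.ext (perm_one v.1) ?_
  change v.2 - pair P (0 : weightLattice P) _ = v.2
  rw [pair_zero, sub_zero]

lemma affPerm_mul (g h : ExtAffineWeyl P) (v : ι × ℤ) :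
    affPerm (g * h) v = affPerm g (affPerm h v) := by
  refine Prod.ext (perm_mul _ _ _) ?_
  change v.2 - pair P (g.left.toAdd + g.right • h.left.toAdd) (perm P (g.right * h.right) v.1) =
    v.2 - pair P h.left.toAdd (perm P h.right v.1) -
      pair P g.left.toAdd (perm P g.right (perm P h.right v.1))
  rw [pair_add, perm_mul, pair_smul_perm]
  ring

/-- The negative of an affine root. -/
def affNeg (P : RootPairing ι ℝ M N) (v : ι × ℤ) : ι × ℤ := (opp P v.1, -v.2)

lemma affPerm_affNeg (g : ExtAffineWeyl P) (v : ι × ℤ) :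
    affPerm g (affNeg P v) = affNeg P (affPerm g v) := by
  refine Prod.ext (perm_opp _ _) ?_
  change -v.2 - pair P g.left.toAdd (perm P g.right (opp P v.1)) =
    -(v.2 - pair P g.left.toAdd (perm P g.right v.1))
  rw [perm_opp, pair_opp]
  ring

lemma affPerm_affineReflection_self (v : ι × ℤ) :
    affPerm (affineReflection P v.1 v.2) v = affNeg P v := by
  refine Prod.ext (perm_refl_self _) ?_
  change v.2 - pair P (-(v.2 • rootWeight P v.1)) (perm P (refl P v.1) v.1) = -v.2
  rw [perm_refl_self, pair_opp, pair_neg, pair_zsmul, pair_rootWeight, P.pairingIn_same]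
  ring

lemma smul_eq_sub (i : ι) (c : weightLattice P) :
    refl P i • c = c - pair P c i • rootWeight P i := by
  refine Subtype.ext ?_
  change refl P i • (c : M) = (c : M) - ((pair P c i • rootWeight P i : weightLattice P) : M)
  rw [refl_smul, pair_spec, AddSubgroup.coe_zsmul, Int.cast_smul_eq_zsmul]
  rfl

/-- The affine version of g s_v g⁻¹ = s_{g v}; it moves a reflection past a letter in the exchange
argument. -/
lemma affineReflection_affPerm (g : ExtAffineWeyl P) (v : ι × ℤ) :
    affineReflection P (affPerm g v).1 (affPerm g v).2 * g =
      g * affineReflection P v.1 v.2 := by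
  refine SemidirectProduct.ext ?_ ?_
  · refine Multiplicative.toAdd.injective ?_
    change -((v.2 - pair P g.left.toAdd (perm P g.right v.1)) •
        rootWeight P (perm P g.right v.1)) + refl P (perm P g.right v.1) • g.left.toAdd =
      g.left.toAdd + g.right • (-(v.2 • rootWeight P v.1))
    rw [smul_eq_sub, smul_neg, smul_comm g.right, ← rootWeight_perm, sub_smul]
    abel
  · change refl P (perm P g.right v.1) * g.right = g.right * refl P v.1
    rw [refl_perm, inv_mul_cancel_right]

section Positive

variable (b : P.Base)

open scoped Classical in
/-- `0` for positive roots and `1` for negative roots: the affine root `[α, ν_α j]` is positive if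
and only if `j ≥ ε(α)`. -/
def eps (i : ι) : ℤ := if b.IsPos i then 0 else 1

variable {b} in
lemma eps_pos {i : ι} (h : b.IsPos i) : eps b i = 0 := if_pos h

variable {b} in
lemma eps_neg {i : ι} (h : ¬ b.IsPos i) : eps b i = 1 := if_neg h

lemma eps_nonneg (i : ι) : 0 ≤ eps b i := by rw [eps]; split_ifs <;> simp

lemma eps_le_one (i : ι) : eps b i ≤ 1 := by rw [eps]; split_ifs <;> simp

lemma eps_opp (i : ι) : eps b (opp P i) = 1 - eps b i := by
  by_cases h : b.IsPos i
  · rw [eps_pos h, eps_neg (by rw [isPos_opp]; simpa using h), sub_zero]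
  · rw [eps_neg h, eps_pos (by rw [isPos_opp]; simpa using h), sub_self]

/-- Positive affine roots. -/
def AffPos (v : ι × ℤ) : Prop := eps b v.1 ≤ v.2

lemma affPos_affNeg {v : ι × ℤ} : AffPos b (affNeg P v) ↔ ¬ AffPos b v := by
  have h : eps b (affNeg P v).1 = 1 - eps b v.1 := eps_opp b v.1
  rw [AffPos, AffPos, h]
  change 1 - eps b v.1 ≤ -v.2 ↔ _
  omega

variable [P.IsRootSystem] [P.IsIrreducible]

lemma affPos_affineSimple (k : Option b.support) : AffPos b (affineSimple b k) := by
  cases k with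
  | none => exact eps_le_one b _
  | some k => exact (eps_pos (RootPairing.Base.isPos_of_mem_support k.2)).le

lemma isPos_of_pairingIn_maxShort_pos {i : ι} (h : 0 < P.pairingIn ℤ (maxShort b) i) :
    b.IsPos i := by
  by_contra hi
  have h1 := maxShort_dominant b ((isPos_opp b).2 hi)
  rw [← pair_rootWeight, pair_opp, pair_rootWeight] at h1
  omega

/-- A simple reflection permutes the positive affine roots other than the corresponding simple
affine root. -/
lemma affPos_simpleReflection [P.IsReduced] {k : Option b.support} {v : ι × ℤ} (hv : AffPos b v)
    (hk : v ≠ affineSimple b k) : AffPos b (affPerm (simpleReflection b k) v) := by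
  obtain ⟨i, j⟩ := v
  change eps b i ≤ j at hv
  have h0 := eps_nonneg b i
  cases k with
  | some k =>
    change eps b (perm P (refl P k) i) ≤
      j - pair P (-((0 : ℤ) • rootWeight P (k : ι))) (perm P (refl P k) i)
    rw [zero_smul, neg_zero, pair_zero, sub_zero, perm_refl]
    by_cases hj : 1 ≤ j
    · exact (eps_le_one b _).trans hj
    · have hj0 : j = 0 := by omega
      subst hj0
      have hi : b.IsPos i := by
        by_contra h
        rw [eps_neg h] at hv
        omega
      have hik : i ≠ k := fun h => hk (by rw [h]; rfl)
      exact (eps_pos (hi.reflectionPerm k.2 hik)).le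
  | none =>
    set θ := maxShort b with hθ
    have hp : b.IsPos θ := isPos_maxShort b
    change eps b (perm P (refl P (opp P θ)) i) ≤
      j - pair P (-((1 : ℤ) • rootWeight P (opp P θ))) (perm P (refl P (opp P θ)) i)
    rw [refl_opp, one_smul, rootWeight_opp, neg_neg, perm_refl, pair_rootWeight,
      pairingIn_reflectionPerm_right, sub_neg_eq_add]
    -- The goal now reads ε(s_ϑ α) ≤ j + (ϑ, α^∨). For positive α the pairing is nonnegative. For
    -- negative α it is -2 at α = -ϑ, where j ≥ 2 since the root is not α_0, and otherwise at least
    -- -1 because ϑ is short. The value -1 makes s_ϑ α positive, so the threshold drops to 0.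
    have hε := eps_le_one b (P.reflectionPerm θ i)
    by_cases hi : b.IsPos i
    · have h1 : 0 ≤ P.pairingIn ℤ θ i := maxShort_dominant b hi
      rcases h1.eq_or_lt with h2 | h2
      · have h3 : P.reflectionPerm θ i = i := by
          apply P.root.injective
          have h4 := nu_mul_pairingIn (P := P) θ i
          rw [← h2, show nu P θ = 1 from isShort_maxShort b, Int.cast_zero, mul_zero, one_mul] at h4
          rw [root_reflectionPerm_eq, Int.cast_eq_zero.1 h4, zero_smul, sub_zero]
        rw [h3]
        omega
      · omega
    · rw [eps_neg hi] at hv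
      by_cases h1 : i = opp P θ
      · have h2 : j ≠ 1 := fun h => hk (by rw [h, h1]; rfl)
        rw [h1]
        have h3 : P.reflectionPerm θ (opp P θ) = θ := P.reflectionPerm_self θ θ
        rw [h3, eps_pos hp, ← pair_rootWeight, pair_opp, pair_rootWeight, P.pairingIn_same]
        omega
      · have h2 : θ ≠ i := fun h => hi (h ▸ hp)
        have h3 : θ ≠ opp P i := fun h => h1 (by rw [h, opp_opp])
        have h4 := abs_le.1 ((isShort_maxShort b).abs_pairingIn_le h2 h3)
        rw [← hθ] at h4
        by_cases h5 : P.pairingIn ℤ θ i = -1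
        · have h6 : b.IsPos (P.reflectionPerm θ i) := by
            apply isPos_of_pairingIn_maxShort_pos
            rw [← hθ, pairingIn_reflectionPerm_right, h5]
            norm_num
          rw [eps_pos h6]
          omega
        · omega

lemma prod_simpleReflection_reverse (L : List (Option b.support)) :
    ((L.reverse).map (simpleReflection b)).prod = ((L.map (simpleReflection b)).prod)⁻¹ := by
  rw [List.prod_inv_reverse, List.map_reverse, List.map_map]
  congr 2
  refine List.map_congr_left fun i _ => ?_
  exact (inv_eq_of_mul_eq_one_left (affineReflection_mul_self P _ _)).symm

/-- The exchange condition. -/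
lemma exists_exchange [P.IsReduced] (L : List (Option b.support)) (v : ι × ℤ) (hv : AffPos b v)
    (hL : ¬ AffPos b (affPerm ((L.map (simpleReflection b)).prod)⁻¹ v)) :
    ∃ L' : List (Option b.support), L'.length + 1 = L.length ∧
      affineReflection P v.1 v.2 * (L.map (simpleReflection b)).prod =
        (L'.map (simpleReflection b)).prod := by
  induction L generalizing v with
  | nil =>
    rw [List.map_nil, List.prod_nil, inv_one, affPerm_one] at hL
    exact absurd hv hL
  | cons k L ih =>
    have hkk : simpleReflection b k * simpleReflection b k = 1 := affineReflection_mul_self P _ _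
    -- The letter to delete is the first one whose simple root equals the current image of v. Until
    -- then the image stays positive, and the reflection is conjugated past the letter.
    by_cases hk : v = affineSimple b k
    · refine ⟨L, rfl, ?_⟩
      subst hk
      rw [List.map_cons, List.prod_cons, ← mul_assoc]
      change simpleReflection b k * simpleReflection b k * _ = _
      rw [hkk, one_mul]
    · have hinv : (simpleReflection b k)⁻¹ = simpleReflection b k := inv_eq_of_mul_eq_one_left hkk
      rw [List.map_cons, List.prod_cons, mul_inv_rev, affPerm_mul, hinv] at hL
      obtain ⟨L', h1, h2⟩ := ih _ (affPos_simpleReflection b hv hk) hL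
      refine ⟨k :: L', by simp [← h1], ?_⟩
      have h3 := affineReflection_affPerm (simpleReflection b k) v
      rw [List.map_cons, List.prod_cons, List.map_cons, List.prod_cons, ← h2, ← mul_assoc,
        ← mul_assoc]
      congr 1
      rw [← mul_left_inj (simpleReflection b k), mul_assoc, mul_assoc, hkk, h3, ← mul_assoc, hkk,
        mul_one, one_mul]

/-- The elements of `Π` preserve the set of positive affine roots. -/
lemma IsDiagramAut.affPos_iff [P.IsReduced] {g : ExtAffineWeyl P} (hg : IsDiagramAut b g)
    (v : ι × ℤ) : AffPos b (affPerm g v) ↔ AffPos b v := by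
  set θ := maxShort b with hθ
  have hp : (1 : ℝ) ≤ b.height θ := by
    have : 0 < b.height θ := isPos_maxShort b
    exact_mod_cast this
  -- The affine height: the factor ht ϑ + 1 is chosen so that α_0 = [-ϑ, 1] also gets the value 1.
  let Λ : M × ℝ →ₗ[ℝ] ℝ := (heightForm b).coprod (((b.height θ : ℝ) + 1) • LinearMap.id)
  have hΛ : ∀ z, Λ z = heightForm b z.1 + (b.height θ + 1) * z.2 := fun z => rfl
  let vec : ι × ℤ → M × ℝ := fun v => (P.root v.1, nu P v.1 * v.2)
  have hact : ∀ v, affineAct P g (vec v) = vec (affPerm g v) := by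
    intro v
    refine Prod.ext (root_perm _ _).symm ?_
    change nu P v.1 * v.2 - form P (g.right • P.root v.1) (g.left.toAdd : M) =
      nu P (perm P g.right v.1) *
        ((v.2 - pair P g.left.toAdd (perm P g.right v.1) : ℤ) : ℝ)
    rw [← root_perm, form_comm, form_root, pair_spec, nu_perm]
    push_cast
    ring
  -- For j ≠ 0 the term (ht ϑ + 1) ν_α j outweighs ht α, since |ht α| ≤ ν_α ht ϑ by
  -- `height_le_nu_mul` applied to α and -α.
  have hpos : ∀ v, AffPos b v ↔ 0 < Λ (vec v) := by
    rintro ⟨i, j⟩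
    rw [hΛ]
    change eps b i ≤ j ↔ 0 < heightForm b (P.root i) + (b.height θ + 1) * (nu P i * (j : ℝ))
    rw [heightForm_root]
    have h1 := height_le_nu_mul b i
    have h2 := height_le_nu_mul b (opp P i)
    rw [height_opp, nu_opp] at h2
    push_cast at h2
    rw [← hθ] at h1 h2
    have hν := nu_pos (P := P) i
    rcases lt_trichotomy j 0 with hj | hj | hj
    · have hj' : (j : ℝ) ≤ -1 := by exact_mod_cast (by omega : j ≤ -1)
      have h0 := eps_nonneg b i
      refine iff_of_false (by omega) (not_lt.2 ?_)
      have h3 := mul_le_mul_of_nonneg_left hj' (mul_nonneg (by linarith : (0:ℝ) ≤ b.height θ + 1) hν.le)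
      nlinarith
    · subst hj
      rw [Int.cast_zero, mul_zero, mul_zero, add_zero]
      by_cases hi : b.IsPos i
      · rw [eps_pos hi]
        refine iff_of_true le_rfl ?_
        have : 0 < b.height i := hi
        exact_mod_cast this
      · rw [eps_neg hi]
        refine iff_of_false (by norm_num) ?_
        have : ¬ 0 < b.height i := hi
        exact_mod_cast this
    · have hj' : (1 : ℝ) ≤ j := by exact_mod_cast hj
      have h0 := eps_le_one b i
      refine iff_of_true (by omega) ?_
      have h3 := mul_le_mul_of_nonneg_left hj' (mul_nonneg (by linarith : (0:ℝ) ≤ b.height θ + 1) hν.le)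
      nlinarith
  have hsimple : ∀ z ∈ Set.range (affineSimpleVec b), Λ z = 1 := by
    rintro _ ⟨k, rfl⟩
    rw [hΛ]
    cases k with
    | none =>
      change heightForm b (P.root (opp P θ)) + (b.height θ + 1) * (nu P (opp P θ) * ((1 : ℤ) : ℝ)) = 1
      rw [heightForm_root, height_opp, nu_opp, show nu P θ = 1 from isShort_maxShort b]
      push_cast
      ring
    | some k =>
      change heightForm b (P.root k) + (b.height θ + 1) * (nu P k * ((0 : ℤ) : ℝ)) = 1
      rw [heightForm_root, RootPairing.Base.height_one_of_mem_support k.2]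
      simp
  let S : Submodule ℝ (M × ℝ) :=
    { carrier := {z | Λ (affineAct P g z) = Λ z}
      zero_mem' := by
        change Λ (affineAct P g 0) = Λ 0
        have : affineAct P g (0 : M × ℝ) = 0 := by simp [affineAct, form]
        rw [this]
      add_mem' := by
        intro x y hx hy
        change Λ (affineAct P g (x + y)) = Λ (x + y)
        have : affineAct P g (x + y) = affineAct P g x + affineAct P g y := by
          refine Prod.ext (smul_add _ _ _) ?_
          change x.2 + y.2 - form P (g.right • (x.1 + y.1)) _ =
            (x.2 - form P (g.right • x.1) _) + (y.2 - form P (g.right • y.1) _)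
          rw [smul_add, form_add_left]
          ring
        rw [this, map_add, map_add, show Λ (affineAct P g x) = Λ x from hx,
          show Λ (affineAct P g y) = Λ y from hy]
      smul_mem' := by
        intro r x hx
        change Λ (affineAct P g (r • x)) = Λ (r • x)
        have : affineAct P g (r • x) = r • affineAct P g x := by
          refine Prod.ext (smul_comm _ _ _) ?_
          change r * x.2 - form P (g.right • (r • x.1)) _ = r * (x.2 - form P (g.right • x.1) _)
          rw [smul_comm g.right r, form_smul_left]
          ring
        rw [this, map_smul, map_smul, show Λ (affineAct P g x) = Λ x from hx] }
  -- An element of Π permutes the simple affine roots, on which Λ is constantly 1. They span M × ℝ,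
  -- so Λ is invariant under Π, and hence so is positivity.
  have hS : ∀ k, affineSimpleVec b k ∈ S := by
    intro k
    change Λ (affineAct P g _) = Λ _
    rw [hsimple _ ⟨k, rfl⟩, hsimple]
    rw [← show affineAct P g '' Set.range (affineSimpleVec b) = _ from hg]
    exact ⟨_, ⟨k, rfl⟩, rfl⟩
  have hS1 : ∀ x : M, (x, (0 : ℝ)) ∈ S := by
    have h : (⊤ : Submodule ℝ M) ≤ S.comap (LinearMap.inl ℝ M ℝ) := by
      rw [← b.toWeightBasis.span_eq, Submodule.span_le]
      rintro _ ⟨k, rfl⟩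
      rw [b.toWeightBasis_apply]
      have := hS (some k)
      rw [affineSimpleVec] at this
      simpa [affineSimple] using! this
    exact fun x => h Submodule.mem_top
  have hS2 : ((0 : M), (1 : ℝ)) ∈ S := by
    have h := S.add_mem (hS none) (hS1 (P.root θ))
    have e : affineSimpleVec b none + (P.root θ, (0 : ℝ)) = (0, 1) := by
      refine Prod.ext ?_ ?_
      · change P.root (opp P θ) + P.root θ = 0
        rw [root_opp, neg_add_cancel]
      · change nu P (opp P θ) * ((1 : ℤ) : ℝ) + 0 = 1
        rw [nu_opp, show nu P θ = 1 from isShort_maxShort b]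
        simp
    rwa [e] at h
  have hall : ∀ z, Λ (affineAct P g z) = Λ z := by
    intro z
    have h := S.add_mem (hS1 z.1) (S.smul_mem z.2 hS2)
    have e : (z.1, (0 : ℝ)) + z.2 • ((0 : M), (1 : ℝ)) = z := by
      refine Prod.ext ?_ ?_ <;> simp
    rw [e] at h
    exact h
  rw [hpos, hpos, ← hact, hall]

variable {b} in
/-- For a reduced decomposition of the translation by a dominant weight, the affine roots
`s_{i_l} ⋯ s_{i_{k+1}} (α_{i_k})` have positive finite parts. -/
lemma IsReducedExpression.isPos [P.IsReduced] {c : weightLattice P}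
    (hc : ∀ i, b.IsPos i → 0 ≤ pair P c i) {π : ExtAffineWeyl P} {L : List (Option b.support)}
    (h : IsReducedExpression b (translation P c) π L) {L₁ L₂ : List (Option b.support)}
    {k : Option b.support} (hL : L = L₁ ++ k :: L₂) :
    b.IsPos (perm P ((L₂.map (simpleReflection b)).prod).right⁻¹ (affineSimple b k).1) := by
  obtain ⟨⟨hπ, hg⟩, hmin⟩ := h
  have hkk : simpleReflection b k * simpleReflection b k = 1 := affineReflection_mul_self P _ _
  set p₁ := (L₁.map (simpleReflection b)).prod with hp₁
  set p₂ := (L₂.map (simpleReflection b)).prod with hp₂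
  have hprod : (L.map (simpleReflection b)).prod = p₁ * (simpleReflection b k * p₂) := by
    rw [hL, List.map_append, List.prod_append, List.map_cons, List.prod_cons]
  rw [hprod] at hg
  -- If this root were negative, exchange would shorten k :: L₂ by two letters, against minimality.
  -- The same argument on the reversed left part gives `h2`.
  have h1 : AffPos b (affPerm p₂⁻¹ (affineSimple b k)) := by
    by_contra hn
    obtain ⟨L', hl, he⟩ := exists_exchange b L₂ _ (affPos_affineSimple b k) hn
    have := hmin π (L₁ ++ L') ⟨hπ, by
      rw [hg, List.map_append, List.prod_append, ← he]
      rfl⟩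
    rw [hL] at this
    simp at this
    omega
  have h2 : AffPos b (affPerm p₁ (affineSimple b k)) := by
    by_contra hn
    obtain ⟨L', hl, he⟩ := exists_exchange b L₁.reverse _ (affPos_affineSimple b k)
      (by rw [prod_simpleReflection_reverse, inv_inv]; exact hn)
    rw [prod_simpleReflection_reverse, ← hp₁] at he
    have hrev' : ((L'.reverse).map (simpleReflection b)).prod = p₁ * simpleReflection b k := by
      rw [prod_simpleReflection_reverse, ← he, mul_inv_rev, inv_inv]
      congr 1
      exact inv_eq_of_mul_eq_one_left hkk
    have := hmin π (L'.reverse ++ L₂) ⟨hπ, by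
      rw [hg, List.map_append, List.prod_append, hrev', mul_assoc]⟩
    rw [hL] at this
    simp at this hl
    omega
  -- The translation is π p₁ s_k p₂, so it sends this root to π p₁(-α_k), which is negative by `h2`
  -- and the invariance of positivity under π.
  have h3 : ¬ AffPos b (affPerm (translation P c) (affPerm p₂⁻¹ (affineSimple b k))) := by
    rw [← affPerm_mul, hg, mul_assoc, mul_assoc, mul_assoc, mul_inv_cancel, mul_one, affPerm_mul,
      hπ.affPos_iff, affPerm_mul]
    have e : affPerm (simpleReflection b k) (affineSimple b k) = affNeg P (affineSimple b k) :=
      affPerm_affineReflection_self _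
    rw [e, affPerm_affNeg, affPos_affNeg, not_not]
    exact h2
  by_contra hn
  have e : (affPerm p₂⁻¹ (affineSimple b k)).1 = perm P p₂.right⁻¹ (affineSimple b k).1 := rfl
  rw [← e] at hn
  generalize affPerm p₂⁻¹ (affineSimple b k) = v at h1 h3 hn
  apply h3
  change eps b (perm P 1 v.1) ≤ v.2 - pair P c (perm P 1 v.1)
  rw [perm_one]
  -- If the finite part α were negative, dominance would give (c, α^∨) ≤ 0. The translation would
  -- then not lower the integer part and could not make the root negative.
  have h4 := hc _ ((isPos_opp b).2 hn)
  rw [pair_opp] at h4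
  have h5 : eps b v.1 ≤ v.2 := h1
  omega

end Positive

end AffineRoots

/-! ### Monomials in the parameters: inversion monomials and the ρ-character -/

section Monomials

variable {ι M N : Type*} [Fintype ι] [AddCommGroup M] [Module ℝ M] [AddCommGroup N] [Module ℝ N]
  {P : RootPairing ι ℝ M N}

lemma sqrtT_eq_of_nu {i j : ι} (h : nu P i = nu P j) : sqrtT P i = sqrtT P j := by
  refine Units.ext ?_
  change algebraMap _ _ (MvPolynomial.X _) = algebraMap _ _ (MvPolynomial.X _)
  congr 2
  exact Subtype.ext h

lemma sqrtT_perm (w : P.weylGroup) (i : ι) : sqrtT P (perm P w i) = sqrtT P i :=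
  sqrtT_eq_of_nu (nu_perm w i)

lemma sqrtT_opp (i : ι) : sqrtT P (opp P i) = sqrtT P i := sqrtT_eq_of_nu (nu_opp i)

variable (P) in
/-- The monomials in the `t_ν^{1/2}` with nonnegative exponents. -/
def integralMonomials : Submonoid (Kqt P)ˣ := Submonoid.closure (Set.range (sqrtT P))

lemma sqrtT_mem (i : ι) : sqrtT P i ∈ integralMonomials P :=
  Submonoid.subset_closure ⟨i, rfl⟩

lemma sqrtT_zpow_mem (i : ι) {n : ℤ} (hn : 0 ≤ n) : sqrtT P i ^ n ∈ integralMonomials P := by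
  lift n to ℕ using hn
  rw [zpow_natCast]
  exact pow_mem (sqrtT_mem i) n

lemma prod_sqrtT_mem {s : Finset ι} {n : ι → ℤ} (hn : ∀ i ∈ s, 0 ≤ n i) :
    ∏ i ∈ s, sqrtT P i ^ n i ∈ integralMonomials P :=
  prod_mem fun i hi => sqrtT_zpow_mem i (hn i hi)

lemma prod_sqrtT_mul_zpow_mem {s : Finset ι} {n : ι → ℤ} (hn : ∀ i ∈ s, 0 ≤ n i) {j : ι}
    (hj : j ∈ s) {m : ℤ} (hm : m ≤ n j) :
    (∏ i ∈ s, sqrtT P i ^ n i) * sqrtT P j ^ (-m) ∈ integralMonomials P := by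
  classical
  rw [← Finset.mul_prod_erase s _ hj, mul_right_comm, ← zpow_add]
  exact mul_mem (sqrtT_zpow_mem j (by omega))
    (prod_sqrtT_mem fun i hi => hn i (Finset.mem_of_mem_erase hi))

variable [P.IsCrystallographic] (b : P.Base)

open scoped Classical in
/-- The monomial `∏ t_α^{1/2}` over the positive roots `α` such that `u α` is negative. -/
def inversionMonomial (u : P.weylGroup) : (Kqt P)ˣ :=
  ∏ i with b.IsPos i, sqrtT P i ^ eps b (perm P u i)

open scoped Classical in
/-- The positive roots `α` such that `s_β α` is negative. -/
def inversions (j : ι) : Finset ι :=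
  Finset.univ.filter fun i => b.IsPos i ∧ ¬ b.IsPos (P.reflectionPerm j i)

variable {b}

lemma mem_inversions {i j : ι} :
    i ∈ inversions b j ↔ b.IsPos i ∧ ¬ b.IsPos (P.reflectionPerm j i) := by
  simp [inversions]

lemma self_mem_inversions {j : ι} (hj : b.IsPos j) : j ∈ inversions b j :=
  mem_inversions.2 ⟨hj, fun h => (isPos_opp b).1 h hj⟩

/-- If (α, β^∨) were not positive, s_β α = α - (α, β^∨) β would have positive height. -/
lemma pairingIn_pos_of_mem_inversions {i j : ι} (hj : b.IsPos j) (hi : i ∈ inversions b j) :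
    0 < P.pairingIn ℤ i j ∧ 0 < P.pairingIn ℤ j i := by
  obtain ⟨h1, h2⟩ := mem_inversions.1 hi
  have h : 0 < P.pairingIn ℤ i j := by
    rw [RootPairing.Base.isPos_iff', height_reflectionPerm] at h2
    by_contra! h3
    have h4 : 0 < b.height i := h1
    have h5 : 0 < b.height j := hj
    nlinarith
  exact ⟨h, (P.zero_lt_pairingIn_iff' ℤ).1 h⟩

lemma perm_reflectionPerm (u : P.weylGroup) (i j : ι) :
    perm P u (P.reflectionPerm j i) = P.reflectionPerm (perm P u j) (perm P u i) := by
  rw [← perm_refl, ← perm_refl, refl_perm, perm_mul, perm_mul, perm_inv_perm]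

lemma height_perm_reflectionPerm (u : P.weylGroup) (i j : ι) :
    b.height (perm P u (P.reflectionPerm j i)) =
      b.height (perm P u i) - P.pairingIn ℤ i j * b.height (perm P u j) := by
  rw [perm_reflectionPerm, height_reflectionPerm, pairingIn_perm]

/-- The exponent of `t_α^{1/2}` in the quotient of the inversion monomials of `u s_β` and `u`. -/
def ratioExponent (b : P.Base) (u : P.weylGroup) (j i : ι) : ℤ :=
  eps b (perm P u (P.reflectionPerm j i)) - eps b (perm P u i)

/-- The positive roots that s_β keeps positive are permuted by s_β with t_α preserved, so they
contribute equally to both sides. Only the inversions of s_β remain. -/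
lemma inversionMonomial_mul_refl (u : P.weylGroup) (j : ι) :
    inversionMonomial b (u * refl P j) =
      inversionMonomial b u * ∏ i ∈ inversions b j, sqrtT P i ^ ratioExponent b u j i := by
  classical
  have hs : ∀ f : ι → (Kqt P)ˣ, ∏ i with b.IsPos i, f i =
      (∏ i with (b.IsPos i ∧ b.IsPos (P.reflectionPerm j i)), f i) *
        ∏ i ∈ inversions b j, f i := fun f => by
    rw [← Finset.prod_filter_mul_prod_filter_not _ (fun i => b.IsPos (P.reflectionPerm j i)),
      Finset.filter_filter, Finset.filter_filter]
    congr 1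
  rw [inversionMonomial, inversionMonomial, hs, hs, mul_assoc, ← Finset.prod_mul_distrib]
  congr 1
  · refine Finset.prod_nbij' (P.reflectionPerm j) (P.reflectionPerm j) ?_ ?_ ?_ ?_ ?_
    · intro i hi
      simp only [Finset.mem_filter, Finset.mem_univ, true_and, P.reflectionPerm_self] at hi ⊢
      exact hi.symm
    · intro i hi
      simp only [Finset.mem_filter, Finset.mem_univ, true_and, P.reflectionPerm_self] at hi ⊢
      exact hi.symm
    · exact fun i _ => P.reflectionPerm_self j i
    · exact fun i _ => P.reflectionPerm_self j i
    · intro i _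
      rw [perm_mul, perm_refl, ← perm_refl, sqrtT_perm]
  · refine Finset.prod_congr rfl fun i _ => ?_
    rw [← zpow_add, perm_mul, perm_refl, ratioExponent, add_sub_cancel]

/-- On the positive roots kept positive by s_β the factors of α and s_β α cancel, because (β, (s_β
α)^∨) = -(β, α^∨). Thus q^{(ρ_k, β)} is written over the same index set as the ratio of inversion
monomials. -/
lemma rhoChar_rootWeight (j : ι) : rhoChar b (Multiplicative.ofAdd (rootWeight P j)) =
    ∏ i ∈ inversions b j, sqrtT P i ^ P.pairingIn ℤ j i := by
  classical
  have h0 : rhoChar b (Multiplicative.ofAdd (rootWeight P j)) =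
      ∏ i with b.IsPos i, sqrtT P i ^ P.pairingIn ℤ j i := by
    change ∏ i with b.IsPos i, sqrtT P i ^ pair P (rootWeight P j) i = _
    simp_rw [pair_rootWeight]
  rw [h0, ← Finset.prod_filter_mul_prod_filter_not _ (fun i => b.IsPos (P.reflectionPerm j i)),
    Finset.filter_filter, Finset.filter_filter]
  have h1 : ∏ i with (b.IsPos i ∧ b.IsPos (P.reflectionPerm j i)),
      sqrtT P i ^ P.pairingIn ℤ j i = 1 := by
    refine Finset.prod_involution (fun i _ => P.reflectionPerm j i) ?_ ?_ ?_ ?_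
    · intro i _
      rw [pairingIn_reflectionPerm_right, ← perm_refl, sqrtT_perm, ← zpow_add, add_neg_cancel,
        zpow_zero]
    · intro i _ hne h
      have h2 := pairingIn_reflectionPerm_right (P := P) j i
      rw [h] at h2
      apply hne
      rw [show P.pairingIn ℤ j i = 0 by omega, zpow_zero]
    · intro i hi
      simp only [Finset.mem_filter, Finset.mem_univ, true_and, P.reflectionPerm_self] at hi ⊢
      exact hi.symm
    · exact fun i _ => P.reflectionPerm_self j i
  rw [h1, one_mul]
  refine Finset.prod_congr ?_ fun _ _ => rfl
  ext i
  simp [mem_inversions]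

lemma abs_ratioExponent_le (u : P.weylGroup) (j i : ι) : |ratioExponent b u j i| ≤ 1 := by
  have h1 := eps_nonneg b (perm P u (P.reflectionPerm j i))
  have h2 := eps_le_one b (perm P u (P.reflectionPerm j i))
  have h3 := eps_nonneg b (perm P u i)
  have h4 := eps_le_one b (perm P u i)
  rw [ratioExponent, abs_le]
  omega

/-- Since u s_β α = uα - (α, β^∨) uβ with positive pairing and uβ positive, a negative uα forces u
s_β α to be negative. -/
lemma ratioExponent_nonneg {u : P.weylGroup} {i j : ι} (hj : b.IsPos j)
    (hu : b.IsPos (perm P u j)) (hi : i ∈ inversions b j) : 0 ≤ ratioExponent b u j i := by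
  have h1 := (pairingIn_pos_of_mem_inversions hj hi).1
  have h2 := height_perm_reflectionPerm (b := b) u i j
  have h3 : 0 < b.height (perm P u j) := hu
  rw [ratioExponent]
  by_cases h4 : b.IsPos (perm P u i)
  · rw [eps_pos h4]
    have := eps_nonneg b (perm P u (P.reflectionPerm j i))
    omega
  · rw [eps_neg h4, eps_neg, sub_self]
    rw [RootPairing.Base.isPos_iff'] at h4 ⊢
    rw [h2]
    nlinarith

lemma ratioExponent_nonpos {u : P.weylGroup} {i j : ι} (hj : b.IsPos j)
    (hu : ¬ b.IsPos (perm P u j)) (hi : i ∈ inversions b j) : ratioExponent b u j i ≤ 0 := by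
  have h1 := (pairingIn_pos_of_mem_inversions hj hi).1
  have h2 := height_perm_reflectionPerm (b := b) u i j
  rw [RootPairing.Base.isPos_iff'] at hu
  rw [ratioExponent]
  by_cases h4 : b.IsPos (perm P u i)
  · rw [eps_pos h4, eps_pos, sub_self]
    have h4' : 0 < b.height (perm P u i) := h4
    rw [RootPairing.Base.isPos_iff', h2]
    nlinarith
  · rw [eps_neg h4]
    have := eps_le_one b (perm P u (P.reflectionPerm j i))
    omega

lemma ratioExponent_self (u : P.weylGroup) (j : ι) :
    ratioExponent b u j j = 1 - 2 * eps b (perm P u j) := by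
  rw [ratioExponent, perm_opp, eps_opp]
  ring

/-- All exponents of the ratio are nonnegative when uβ is positive, and the exponent at β itself is
1, which absorbs t_β^{-1/2}. -/
lemma inversionMonomial_ratio_mem {u : P.weylGroup} {j : ι} (hj : b.IsPos j)
    (hu : b.IsPos (perm P u j)) :
    (sqrtT P j)⁻¹ * (inversionMonomial b (u * refl P j) * (inversionMonomial b u)⁻¹) ∈
      integralMonomials P := by
  rw [inversionMonomial_mul_refl, mul_comm (inversionMonomial b u), mul_inv_cancel_right, mul_comm,
    ← zpow_neg_one]
  refine prod_sqrtT_mul_zpow_mem (fun i => ratioExponent_nonneg hj hu) (self_mem_inversions hj) ?_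
  rw [ratioExponent_self, eps_pos hu]
  norm_num

lemma inversionMonomial_ratio_inv_mem {u : P.weylGroup} {j : ι} (hj : b.IsPos j)
    (hu : ¬ b.IsPos (perm P u j)) :
    (sqrtT P j)⁻¹ * (inversionMonomial b u * (inversionMonomial b (u * refl P j))⁻¹) ∈
      integralMonomials P := by
  rw [inversionMonomial_mul_refl, mul_inv, mul_inv_cancel_left, mul_comm, ← Finset.prod_inv_distrib,
    ← zpow_neg_one (sqrtT P j)]
  simp_rw [← zpow_neg]
  refine prod_sqrtT_mul_zpow_mem
    (fun i hi => by have := ratioExponent_nonpos hj hu hi; omega) (self_mem_inversions hj) ?_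
  rw [ratioExponent_self, eps_neg hu]
  norm_num

/-- No sign condition on uβ is needed. Each inversion has ρ-exponent at least 1 against a ratio
exponent at least -1, and at β the total is at least 2 - 1 - 1 = 0. -/
lemma rhoChar_mul_ratio_mem (u : P.weylGroup) {j : ι} (hj : b.IsPos j) :
    rhoChar b (Multiplicative.ofAdd (rootWeight P j)) * (sqrtT P j)⁻¹ *
      (inversionMonomial b (u * refl P j) * (inversionMonomial b u)⁻¹) ∈ integralMonomials P := by
  rw [inversionMonomial_mul_refl, mul_comm (inversionMonomial b u), mul_inv_cancel_right,
    rhoChar_rootWeight, mul_right_comm, ← Finset.prod_mul_distrib, ← zpow_neg_one]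
  simp_rw [← zpow_add]
  refine prod_sqrtT_mul_zpow_mem (fun i hi => ?_) (self_mem_inversions hj) ?_
  · have h1 := (pairingIn_pos_of_mem_inversions hj hi).2
    have h2 := abs_le.1 (abs_ratioExponent_le (b := b) u j i)
    omega
  · have h2 := abs_le.1 (abs_ratioExponent_le (b := b) u j j)
    rw [P.pairingIn_same]
    omega

lemma rhoChar_mul_ratio_inv_mem (u : P.weylGroup) {j : ι} (hj : b.IsPos j) :
    rhoChar b (Multiplicative.ofAdd (rootWeight P j)) * (sqrtT P j)⁻¹ *
      (inversionMonomial b u * (inversionMonomial b (u * refl P j))⁻¹) ∈ integralMonomials P := by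
  rw [inversionMonomial_mul_refl, mul_inv, mul_inv_cancel_left,
    rhoChar_rootWeight, mul_right_comm, ← Finset.prod_inv_distrib, ← Finset.prod_mul_distrib,
    ← zpow_neg_one (sqrtT P j)]
  simp_rw [← zpow_neg, ← zpow_add]
  refine prod_sqrtT_mul_zpow_mem (fun i hi => ?_) (self_mem_inversions hj) ?_
  · have h1 := (pairingIn_pos_of_mem_inversions hj hi).2
    have h2 := abs_le.1 (abs_ratioExponent_le (b := b) u j i)
    omega
  · have h2 := abs_le.1 (abs_ratioExponent_le (b := b) u j j)
    rw [P.pairingIn_same]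
    omega

lemma rhoChar_rootWeight_mul_mem {j : ι} (hj : b.IsPos j) :
    rhoChar b (Multiplicative.ofAdd (rootWeight P j)) * sqrtT P j ^ (-2 : ℤ) ∈
      integralMonomials P := by
  rw [rhoChar_rootWeight]
  refine prod_sqrtT_mul_zpow_mem (fun i hi => (pairingIn_pos_of_mem_inversions hj hi).2.le)
    (self_mem_inversions hj) ?_
  rw [P.pairingIn_same]

variable (b) in
open scoped Classical in
/-- The order in the `t_ν^{1/2}` of the diagonal coefficients of `T_i`. -/
def diagMonomial (j : ι) : (Kqt P)ˣ :=
  (if b.IsPos j then rhoChar b (Multiplicative.ofAdd (rootWeight P j)) else 1) * (sqrtT P j)⁻¹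

/-- This decides whether the scalar term of T_i fits the row bound. For negative γ (the root -j
here) there is no ρ-factor and positivity of the image is essential; for positive γ the ρ-factor
dominates any ratio of inversion monomials. -/
lemma diagMonomial_row {u : P.weylGroup} {j : ι} (hu : b.IsPos (perm P u j)) :
    diagMonomial b (opp P j) *
      (inversionMonomial b (u * refl P j) * (inversionMonomial b u)⁻¹) ∈ integralMonomials P := by
  by_cases hj : b.IsPos j
  · rw [diagMonomial, if_neg (by rw [isPos_opp]; simpa using hj), one_mul, sqrtT_opp]
    exact inversionMonomial_ratio_mem hj hu
  · have hj' : b.IsPos (opp P j) := (isPos_opp b).2 hj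
    rw [diagMonomial, if_pos hj', ← refl_opp]
    exact rhoChar_mul_ratio_mem u hj'

/-- The counterpart for T_i⁻¹, whose scalar term has the order attached to the opposite root. -/
lemma diagMonomial_column {u : P.weylGroup} {j : ι} (hu : b.IsPos (perm P u j)) :
    diagMonomial b j *
      (inversionMonomial b u * (inversionMonomial b (u * refl P j))⁻¹) ∈ integralMonomials P := by
  by_cases hj : b.IsPos j
  · rw [diagMonomial, if_pos hj]
    exact rhoChar_mul_ratio_inv_mem u hj
  · have hj' : b.IsPos (opp P j) := (isPos_opp b).2 hj
    rw [diagMonomial, if_neg hj, ← refl_opp, one_mul, ← sqrtT_opp]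
    refine inversionMonomial_ratio_inv_mem hj' ?_
    rw [perm_opp, isPos_opp]
    simpa using hu

/-- The weights of the elements of `Π` are differences of inversion indicators. -/
lemma pair_left_of_affPos_iff {g : ExtAffineWeyl P} (i : ι)
    (hg : ∀ j : ℤ, AffPos b (affPerm g (i, j)) ↔ AffPos b (i, j)) :
    pair P g.left.toAdd (perm P g.right i) = eps b i - eps b (perm P g.right i) := by
  -- ε(α) is the least integer making (α, j) positive, so preservation of positivity carries this
  -- threshold to the threshold of the image root.
  have h1 := (hg (eps b i)).2 le_rfl
  have h2 : AffPos b (i, eps b (perm P g.right i) + pair P g.left.toAdd (perm P g.right i)) := by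
    rw [← hg]
    change eps b (perm P g.right i) ≤ _ - pair P g.left.toAdd (perm P g.right i)
    omega
  change eps b (perm P g.right i) ≤ eps b i - pair P g.left.toAdd (perm P g.right i) at h1
  change eps b i ≤ _ + _ at h2
  omega

/-- The exponent of t_α^{1/2} is (c, (uα)^∨). When this is a difference of values of ε up to an
error f, the ε-parts assemble into two inversion monomials. -/
lemma rhoChar_inv_smul (u : P.weylGroup) (c : weightLattice P) {f : ι → ℤ} {w : P.weylGroup}
    (h : ∀ i, pair P c i = eps b (perm P w⁻¹ i) - eps b i + f i) :
    rhoChar b (Multiplicative.ofAdd (u⁻¹ • c)) =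
      inversionMonomial b (w⁻¹ * u) * (inversionMonomial b u)⁻¹ *
        open scoped Classical in ∏ i with b.IsPos i, sqrtT P i ^ f (perm P u i) := by
  classical
  change ∏ i with b.IsPos i, sqrtT P i ^ pair P (u⁻¹ • c) i = _
  rw [inversionMonomial, inversionMonomial, ← Finset.prod_inv_distrib, ← Finset.prod_mul_distrib,
    ← Finset.prod_mul_distrib]
  refine Finset.prod_congr rfl fun i _ => ?_
  rw [pair_smul, inv_inv, h, perm_mul, ← zpow_neg, ← zpow_add, ← zpow_add]
  rfl

lemma rhoChar_of_affPos_iff (u : P.weylGroup) {g : ExtAffineWeyl P}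
    (hg : ∀ v, AffPos b (affPerm g v) ↔ AffPos b v) :
    rhoChar b (Multiplicative.ofAdd (u⁻¹ • g.left.toAdd)) =
      inversionMonomial b (g.right⁻¹ * u) * (inversionMonomial b u)⁻¹ := by
  rw [rhoChar_inv_smul u _ (f := fun _ => 0) (w := g.right)]
  · simp
  · intro i
    have := pair_left_of_affPos_iff (perm P g.right⁻¹ i) fun j => hg (_, j)
    rw [perm_perm_inv] at this
    rw [this, add_zero]

variable [P.IsRootSystem] [P.IsIrreducible] [P.IsReduced]

-- Away from the two roots ±α_k a simple reflection behaves like an element of Π, so its weight is a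
-- difference of ε-values; the correction ∓1 sits at those two roots.
open scoped Classical in
lemma pair_simpleReflection (k : Option b.support) (i : ι) :
    pair P (simpleReflection b k).left.toAdd i =
      eps b (perm P (simpleReflection b k).right⁻¹ i) - eps b i +
        (if i = (affineSimple b k).1 then -1 else if i = opp P (affineSimple b k).1 then 1
          else 0) := by
  set a := (affineSimple b k).1 with ha
  have hr : (simpleReflection b k).right = refl P a := rfl
  have hl : (simpleReflection b k).left.toAdd = -((affineSimple b k).2 • rootWeight P a) := rfl
  -- Simple affine roots lie on the threshold of positivity: 0 for α_i and 1 for α_0, whose finite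
  -- part is negative.
  have hε : (affineSimple b k).2 = eps b a := by
    cases k with
    | none =>
      rw [ha]
      exact (eps_neg (fun h => (isPos_opp b).1 h (isPos_maxShort b))).symm
    | some k => exact (eps_pos (RootPairing.Base.isPos_of_mem_support k.2)).symm
  rw [hr, refl_inv, perm_refl]
  by_cases h1 : i = a
  · rw [if_pos h1, h1, hl, pair_neg, pair_zsmul, pair_rootWeight, P.pairingIn_same, eps_opp, hε]
    ring
  by_cases h2 : i = opp P a
  · have h3 : P.reflectionPerm a (opp P a) = a := P.reflectionPerm_self a a
    rw [if_neg h1, if_pos h2, h2, h3, hl, pair_opp, pair_neg, pair_zsmul, pair_rootWeight,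
      P.pairingIn_same, eps_opp, hε]
    ring
  rw [if_neg h1, if_neg h2, add_zero]
  have hinv : ∀ v, affPerm (simpleReflection b k) (affPerm (simpleReflection b k) v) = v := by
    intro v
    rw [← affPerm_mul, simpleReflection, affineReflection_mul_self, affPerm_one]
  have h3 : P.reflectionPerm a i ≠ a := fun h => h2 (by rw [← P.reflectionPerm_self a i, h])
  have key := pair_left_of_affPos_iff (b := b) (g := simpleReflection b k) (P.reflectionPerm a i)
    (fun j => ?_)
  · rw [hr, perm_refl, P.reflectionPerm_self] at key
    exact key
  · refine ⟨fun h => ?_, fun h => affPos_simpleReflection b h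
      fun he => h3 (congrArg Prod.fst he)⟩
    rw [← hinv (P.reflectionPerm a i, j)]
    refine affPos_simpleReflection b h fun he => h1 ?_
    have : (affPerm (simpleReflection b k) (P.reflectionPerm a i, j)).1 = i := by
      change perm P (refl P a) (P.reflectionPerm a i) = i
      rw [perm_refl, P.reflectionPerm_self]
    rw [← this, he]

-- Exactly one of ±u⁻¹α_k is positive and enters the product, so the correction contributes
-- t_k^{-1/2} or t_k^{1/2}. These factors cancel the orders in
-- `regularAt_twistAut_add_lusztigCoeff`.
open scoped Classical in
lemma rhoChar_simpleReflection (u : P.weylGroup) (k : Option b.support) :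
    rhoChar b (Multiplicative.ofAdd (u⁻¹ • (simpleReflection b k).left.toAdd)) =
      inversionMonomial b ((simpleReflection b k).right⁻¹ * u) * (inversionMonomial b u)⁻¹ *
        (if b.IsPos (perm P u⁻¹ (affineSimple b k).1) then (sqrtT P (affineSimple b k).1)⁻¹
          else sqrtT P (affineSimple b k).1) := by
  rw [rhoChar_inv_smul u _ (pair_simpleReflection k)]
  congr 1
  set a := (affineSimple b k).1
  by_cases hp : b.IsPos (perm P u⁻¹ a)
  · rw [if_pos hp, Finset.prod_eq_single (perm P u⁻¹ a)]
    · rw [perm_perm_inv, if_pos rfl, sqrtT_perm, zpow_neg_one]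
    · intro i hi hne
      rw [if_neg fun h => hne (by rw [← h, perm_inv_perm]), if_neg, zpow_zero]
      intro h
      have h1 : i = opp P (perm P u⁻¹ a) := by rw [← perm_opp, ← h, perm_inv_perm]
      rw [h1, Finset.mem_filter, isPos_opp] at hi
      exact hi.2 hp
    · exact fun h => absurd (Finset.mem_filter.2 ⟨Finset.mem_univ _, hp⟩) h
  · rw [if_neg hp, Finset.prod_eq_single (opp P (perm P u⁻¹ a))]
    · rw [perm_opp, perm_perm_inv, if_neg, if_pos rfl, sqrtT_opp, sqrtT_perm, zpow_one]
      intro h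
      have h1 := root_opp (P := P) a
      rw [h, eq_neg_iff_add_eq_zero, ← two_smul ℝ] at h1
      exact P.ne_zero a ((smul_eq_zero.1 h1).resolve_left two_ne_zero)
    · intro i hi hne
      rw [if_neg, if_neg, zpow_zero]
      · intro h
        apply hne
        rw [← perm_opp, ← h, perm_inv_perm]
      · intro h
        rw [← h, perm_inv_perm] at hp
        rw [Finset.mem_filter] at hi
        exact hp hi.2
    · intro h
      rw [Finset.mem_filter, isPos_opp] at h
      exact absurd ⟨Finset.mem_univ _, hp⟩ h

end Monomials

/-! ### Functions regular at t^{1/2} = 0 and orders of vanishing -/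

section Regular

variable {ι M N : Type*} [Fintype ι] [AddCommGroup M] [Module ℝ M] [AddCommGroup N] [Module ℝ N]
  {P : RootPairing ι ℝ M N} [P.IsCrystallographic]

variable (P) in
/-- `genericValue` as a ring homomorphism. -/
def genericHom : AddMonoidAlgebra (MvPolynomial (nuSet P) Kq) (weightLattice P) →+*
    RatX P (Kqt P) :=
  (algebraMap (AddMonoidAlgebra (Kqt P) (weightLattice P)) (RatX P (Kqt P))).comp
    (AddMonoidAlgebra.mapRingHom (weightLattice P)
      (algebraMap (MvPolynomial (nuSet P) Kq) (Kqt P)))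

variable (P) in
/-- `zeroValue` as a ring homomorphism. -/
def zeroHom : AddMonoidAlgebra (MvPolynomial (nuSet P) Kq) (weightLattice P) →+* RatX P Kq :=
  (algebraMap (AddMonoidAlgebra Kq (weightLattice P)) (RatX P Kq)).comp
    (AddMonoidAlgebra.mapRingHom (weightLattice P) MvPolynomial.constantCoeff)

lemma genericHom_single (a : weightLattice P) (r : MvPolynomial (nuSet P) Kq) :
    genericHom P (AddMonoidAlgebra.single a r) =
      mono P a (algebraMap (MvPolynomial (nuSet P) Kq) (Kqt P) r) := by
  rw [genericHom, RingHom.comp_apply, AddMonoidAlgebra.mapRingHom_single, mono]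

lemma zeroHom_single (a : weightLattice P) (r : MvPolynomial (nuSet P) Kq) :
    zeroHom P (AddMonoidAlgebra.single a r) = mono P a (MvPolynomial.constantCoeff r) := by
  rw [zeroHom, RingHom.comp_apply, AddMonoidAlgebra.mapRingHom_single, mono]

lemma genericHom_injective : Function.Injective (genericHom P) := by
  refine (IsFractionRing.injective (AddMonoidAlgebra (Kqt P) (weightLattice P))
    (RatX P (Kqt P))).comp ?_
  exact AddMonoidAlgebra.map_injective _
    (IsFractionRing.injective (MvPolynomial (nuSet P) Kq) (Kqt P))

lemma genericHom_ne_zero {d : AddMonoidAlgebra (MvPolynomial (nuSet P) Kq) (weightLattice P)}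
    (hd : zeroHom P d ≠ 0) : genericHom P d ≠ 0 := by
  intro h
  rw [map_eq_zero_iff _ genericHom_injective] at h
  exact hd (by rw [h, map_zero])

lemma isLimit_iff {f : RatX P (Kqt P)} {g : RatX P Kq} : IsLimit P f g ↔
    ∃ n d, zeroHom P d ≠ 0 ∧ f = genericHom P n / genericHom P d ∧
      g = zeroHom P n / zeroHom P d := Iff.rfl

lemma isLimit_hom (n : AddMonoidAlgebra (MvPolynomial (nuSet P) Kq) (weightLattice P)) :
    IsLimit P (genericHom P n) (zeroHom P n) :=
  isLimit_iff.2 ⟨n, 1, by simp, by simp, by simp⟩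

lemma IsLimit.add {f f' : RatX P (Kqt P)} {g g' : RatX P Kq} (h : IsLimit P f g)
    (h' : IsLimit P f' g') : IsLimit P (f + f') (g + g') := by
  obtain ⟨n, d, hd, rfl, rfl⟩ := isLimit_iff.1 h
  obtain ⟨n', d', hd', rfl, rfl⟩ := isLimit_iff.1 h'
  refine isLimit_iff.2 ⟨n * d' + d * n', d * d', ?_, ?_, ?_⟩
  · rw [map_mul]
    exact mul_ne_zero hd hd'
  · simp only [map_add, map_mul]
    rw [div_add_div _ _ (genericHom_ne_zero hd) (genericHom_ne_zero hd')]
  · simp only [map_add, map_mul]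
    rw [div_add_div _ _ hd hd']

lemma IsLimit.mul {f f' : RatX P (Kqt P)} {g g' : RatX P Kq} (h : IsLimit P f g)
    (h' : IsLimit P f' g') : IsLimit P (f * f') (g * g') := by
  obtain ⟨n, d, hd, rfl, rfl⟩ := isLimit_iff.1 h
  obtain ⟨n', d', hd', rfl, rfl⟩ := isLimit_iff.1 h'
  refine isLimit_iff.2 ⟨n * n', d * d', ?_, ?_, ?_⟩
  · rw [map_mul]
    exact mul_ne_zero hd hd'
  · simp only [map_mul]
    rw [div_mul_div_comm]
  · simp only [map_mul]
    rw [div_mul_div_comm]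

lemma IsLimit.neg {f : RatX P (Kqt P)} {g : RatX P Kq} (h : IsLimit P f g) :
    IsLimit P (-f) (-g) := by
  obtain ⟨n, d, hd, rfl, rfl⟩ := isLimit_iff.1 h
  exact isLimit_iff.2 ⟨-n, d, hd, by rw [map_neg, neg_div], by rw [map_neg, neg_div]⟩

lemma isLimit_zero : IsLimit P 0 0 := by
  have := isLimit_hom (P := P) 0
  rwa [map_zero, map_zero] at this

lemma isLimit_one : IsLimit P 1 1 := by
  have := isLimit_hom (P := P) 1
  rwa [map_one, map_one] at this

lemma IsLimit.inv {f : RatX P (Kqt P)} {g : RatX P Kq} (h : IsLimit P f g) (hg : g ≠ 0) :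
    f ≠ 0 ∧ IsLimit P f⁻¹ g⁻¹ := by
  obtain ⟨n, d, hd, rfl, rfl⟩ := isLimit_iff.1 h
  have hn : zeroHom P n ≠ 0 := fun hn => hg (by rw [hn, zero_div])
  exact ⟨div_ne_zero (genericHom_ne_zero hn) (genericHom_ne_zero hd),
    isLimit_iff.2 ⟨d, n, hn, inv_div _ _, inv_div _ _⟩⟩

variable (P) in
/-- The ring of rational functions that are regular at the point where all `t_ν^{1/2}` are zero. -/
def regularRing : Subring (RatX P (Kqt P)) where
  carrier := {f | ∃ g, IsLimit P f g}
  mul_mem' := fun ⟨_, h⟩ ⟨_, h'⟩ => ⟨_, h.mul h'⟩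
  one_mem' := ⟨_, isLimit_one⟩
  add_mem' := fun ⟨_, h⟩ ⟨_, h'⟩ => ⟨_, h.add h'⟩
  zero_mem' := ⟨_, isLimit_zero⟩
  neg_mem' := fun ⟨_, h⟩ => ⟨_, h.neg⟩

lemma mem_regularRing {f : RatX P (Kqt P)} : f ∈ regularRing P ↔ ∃ g, IsLimit P f g := Iff.rfl

lemma mono_algebraMap_mem (a : weightLattice P) (c : Kq) :
    mono P a (algebraMap Kq (Kqt P) c) ∈ regularRing P := by
  have h := isLimit_hom (P := P) (AddMonoidAlgebra.single a (MvPolynomial.C c))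
  rw [genericHom_single] at h
  exact ⟨_, h⟩

lemma isLimit_mono_sqrtT (i : ι) : IsLimit P (mono P 0 ((sqrtT P i : (Kqt P)ˣ) : Kqt P)) 0 := by
  have h := isLimit_hom (P := P) (AddMonoidAlgebra.single 0 (MvPolynomial.X ⟨nu P i, i, rfl⟩))
  rw [genericHom_single, zeroHom_single, MvPolynomial.constantCoeff_X] at h
  have e : mono P 0 (0 : Kq) = 0 := by rw [mono, AddMonoidAlgebra.single_zero, map_zero]
  rwa [e] at h

lemma mono_zero_mem {m : (Kqt P)ˣ} (hm : m ∈ integralMonomials P) :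
    mono P 0 (m : Kqt P) ∈ regularRing P := by
  induction hm using Submonoid.closure_induction with
  | mem x hx =>
    obtain ⟨i, rfl⟩ := hx
    exact ⟨_, isLimit_mono_sqrtT i⟩
  | one => rw [Units.val_one, mono_zero_one]; exact one_mem _
  | mul x y _ _ hx hy =>
    have : mono P 0 ((x * y : (Kqt P)ˣ) : Kqt P) = mono P 0 (x : Kqt P) * mono P 0 (y : Kqt P) := by
      rw [mono_mul_mono, add_zero, Units.val_mul]
    rw [this]
    exact mul_mem hx hy

/-- `f` is the product of the Laurent monomial `m` in the `t_ν^{1/2}` and a regular function. -/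
def RegularAt (m : (Kqt P)ˣ) (f : RatX P (Kqt P)) : Prop :=
  mono P 0 ((m⁻¹ : (Kqt P)ˣ) : Kqt P) * f ∈ regularRing P

lemma mono_units_mul (m m' : (Kqt P)ˣ) : mono P 0 ((m * m' : (Kqt P)ˣ) : Kqt P) =
    mono P 0 (m : Kqt P) * mono P 0 (m' : Kqt P) := by
  rw [mono_mul_mono, add_zero, Units.val_mul]

lemma mono_units_mul_inv (m : (Kqt P)ˣ) :
    mono P 0 (m : Kqt P) * mono P 0 ((m⁻¹ : (Kqt P)ˣ) : Kqt P) = 1 := by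
  rw [← mono_units_mul, mul_inv_cancel, Units.val_one, mono_zero_one]

lemma inv_mono_units (m : (Kqt P)ˣ) :
    (mono P 0 (m : Kqt P))⁻¹ = mono P 0 ((m⁻¹ : (Kqt P)ˣ) : Kqt P) :=
  inv_eq_of_mul_eq_one_right (mono_units_mul_inv m)

lemma regularAt_one {f : RatX P (Kqt P)} : RegularAt 1 f ↔ f ∈ regularRing P := by
  rw [RegularAt, inv_one, Units.val_one, mono_zero_one, one_mul]

lemma regularAt_zero (m : (Kqt P)ˣ) : RegularAt m (0 : RatX P (Kqt P)) := by
  rw [RegularAt, mul_zero]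
  exact zero_mem _

lemma regularAt_mono (m : (Kqt P)ˣ) : RegularAt m (mono P 0 (m : Kqt P)) := by
  rw [RegularAt, mul_comm, mono_units_mul_inv]
  exact one_mem _

lemma RegularAt.add {m : (Kqt P)ˣ} {f f' : RatX P (Kqt P)} (h : RegularAt m f)
    (h' : RegularAt m f') : RegularAt m (f + f') := by
  rw [RegularAt, mul_add]
  exact add_mem h h'

lemma RegularAt.neg {m : (Kqt P)ˣ} {f : RatX P (Kqt P)} (h : RegularAt m f) :
    RegularAt m (-f) := by
  rw [RegularAt, mul_neg]
  exact neg_mem h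

lemma RegularAt.mul {m m' : (Kqt P)ˣ} {f f' : RatX P (Kqt P)} (h : RegularAt m f)
    (h' : RegularAt m' f') : RegularAt (m * m') (f * f') := by
  rw [RegularAt, mul_inv, mono_units_mul, mul_mul_mul_comm]
  exact mul_mem h h'

lemma RegularAt.of_mem {m m' : (Kqt P)ˣ} {f : RatX P (Kqt P)} (h : RegularAt m f)
    (hm : m * m'⁻¹ ∈ integralMonomials P) : RegularAt m' f := by
  have e : (m'⁻¹ : (Kqt P)ˣ) = m * m'⁻¹ * m⁻¹ := by rw [mul_right_comm, mul_inv_cancel, one_mul]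
  rw [RegularAt, e, mono_units_mul, mul_assoc]
  exact mul_mem (mono_zero_mem hm) h

/-- The regular ring is stable under the `Γ_c`. -/
lemma shiftAut_mem (c : Multiplicative (weightLattice P)) {f : RatX P (Kqt P)}
    (hf : f ∈ regularRing P) : shiftAut P (Kqt P) c f ∈ regularRing P := by
  obtain ⟨g, hg⟩ := hf
  obtain ⟨n, d, hd, rfl, rfl⟩ := isLimit_iff.1 hg
  -- The shift only multiplies X_a by a power of q, a constant independent of t. It therefore lifts
  -- to the polynomial ring and commutes with specialization.
  let σ : AddMonoidAlgebra (MvPolynomial (nuSet P) Kq) (weightLattice P) →+*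
      AddMonoidAlgebra (MvPolynomial (nuSet P) Kq) (weightLattice P) :=
    (AddMonoidAlgebra.lift (MvPolynomial (nuSet P) Kq)
      (AddMonoidAlgebra (MvPolynomial (nuSet P) Kq) (weightLattice P)) (weightLattice P)
      { toFun := fun a => AddMonoidAlgebra.single a.toAdd
          (MvPolynomial.C ((qchar P Kq c a : Kqˣ) : Kq))
        map_one' := by simp [AddMonoidAlgebra.one_def]
        map_mul' := fun a b => by
          simp [AddMonoidAlgebra.single_mul_single] }).toRingHom
  have hσ : ∀ a r, σ (AddMonoidAlgebra.single a r) = AddMonoidAlgebra.single a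
      (MvPolynomial.C ((qchar P Kq c (Multiplicative.ofAdd a) : Kqˣ) : Kq) * r) := by
    intro a r
    refine (AddMonoidAlgebra.lift_single _ _ _).trans ?_
    simp [mul_comm]
  have hq : ∀ a : weightLattice P, algebraMap (MvPolynomial (nuSet P) Kq) (Kqt P)
      (MvPolynomial.C ((qchar P Kq c (Multiplicative.ofAdd a) : Kqˣ) : Kq)) =
      ((qchar P (Kqt P) c (Multiplicative.ofAdd a) : (Kqt P)ˣ) : Kqt P) := by
    intro a
    change _ = algebraMap Kq (Kqt P) _
    rw [IsScalarTower.algebraMap_apply Kq (MvPolynomial (nuSet P) Kq) (Kqt P)]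
    rfl
  have h1 : (genericHom P).comp σ =
      (shiftAut P (Kqt P) c : RatX P (Kqt P) →+* RatX P (Kqt P)).comp (genericHom P) := by
    refine AddMonoidAlgebra.ringHom_ext (fun r => ?_) (fun a => ?_) <;>
      rw [RingHom.comp_apply, RingHom.comp_apply, hσ, genericHom_single, genericHom_single,
        map_mul, hq] <;>
      exact (shiftAut_mono P (Kqt P) c _ _).symm
  have h2 : (zeroHom P).comp σ =
      (shiftAut P Kq c : RatX P Kq →+* RatX P Kq).comp (zeroHom P) := by
    refine AddMonoidAlgebra.ringHom_ext (fun r => ?_) (fun a => ?_) <;>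
      rw [RingHom.comp_apply, RingHom.comp_apply, hσ, zeroHom_single, zeroHom_single,
        map_mul, MvPolynomial.constantCoeff_C] <;>
      exact (shiftAut_mono P Kq c _ _).symm
  have h1' : ∀ x, shiftAut P (Kqt P) c (genericHom P x) = genericHom P (σ x) :=
    fun x => (RingHom.congr_fun h1 x).symm
  have h2' : ∀ x, shiftAut P Kq c (zeroHom P x) = zeroHom P (σ x) :=
    fun x => (RingHom.congr_fun h2 x).symm
  refine ⟨zeroHom P (σ n) / zeroHom P (σ d), isLimit_iff.2 ⟨σ n, σ d, ?_, ?_, rfl⟩⟩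
  · rw [← h2']
    exact (map_ne_zero_iff _ (shiftAut P Kq c).injective).2 hd
  · rw [map_div₀, h1', h1']

lemma RegularAt.shiftAut {m : (Kqt P)ˣ} {f : RatX P (Kqt P)} (h : RegularAt m f)
    (c : Multiplicative (weightLattice P)) : RegularAt m (shiftAut P (Kqt P) c f) := by
  have := shiftAut_mem c h
  rw [map_mul, shiftAut_mono] at this
  rw [RegularAt]
  convert this using 3
  rw [ofAdd_zero, map_one, Units.val_one, one_mul]

section Coefficients

variable {T : (Kqt P)ˣ} {i : ι} {Y : RatX P (Kqt P)}

/-- The hypothesis makes T divisible by t_i, so T Y tends to 0 and 1 - T Y has the limit 1, which is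
invertible. -/
lemma one_sub_inv_mem (hT : T * sqrtT P i ^ (-2 : ℤ) ∈ integralMonomials P)
    (hY : Y ∈ regularRing P) : 1 - mono P 0 (T : Kqt P) * Y ≠ 0 ∧
      (1 - mono P 0 (T : Kqt P) * Y)⁻¹ ∈ regularRing P := by
  have e : mono P 0 (T : Kqt P) = mono P 0 ((sqrtT P i : (Kqt P)ˣ) : Kqt P) *
      (mono P 0 ((sqrtT P i : (Kqt P)ˣ) : Kqt P) *
        mono P 0 ((T * sqrtT P i ^ (-2 : ℤ) : (Kqt P)ˣ) : Kqt P)) := by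
    rw [← mono_units_mul, ← mono_units_mul]
    congr 2
    rw [← mul_assoc (sqrtT P i), ← zpow_two, mul_left_comm, ← zpow_add, add_neg_cancel, zpow_zero,
      mul_one]
  have h : ∃ g, IsLimit P (mono P 0 ((sqrtT P i : (Kqt P)ˣ) : Kqt P) *
        mono P 0 ((T * sqrtT P i ^ (-2 : ℤ) : (Kqt P)ˣ) : Kqt P) * Y) g :=
    mul_mem (mul_mem (mono_zero_mem (sqrtT_mem i)) (mono_zero_mem hT)) hY
  obtain ⟨g, hg⟩ := h
  have h1 := isLimit_one.add ((isLimit_mono_sqrtT i).mul hg).neg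
  rw [← mul_assoc, ← e, zero_mul, neg_zero, add_zero, ← sub_eq_add_neg] at h1
  obtain ⟨h2, h3⟩ := h1.inv one_ne_zero
  exact ⟨h2, _, h3⟩

lemma regularAt_sqrtT_sub_inv (i : ι) :
    RegularAt (sqrtT P i)⁻¹ (mono P 0 ((sqrtT P i : (Kqt P)ˣ) : Kqt P) -
      (mono P 0 ((sqrtT P i : (Kqt P)ˣ) : Kqt P))⁻¹) := by
  rw [sub_eq_add_neg, inv_mono_units]
  refine RegularAt.add ?_ (regularAt_mono _).neg
  refine (regularAt_mono _).of_mem ?_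
  rw [inv_inv]
  exact mul_mem (sqrtT_mem i) (sqrtT_mem i)

/-- Here X = (T Y)⁻¹, and (X - 1)⁻¹ = T Y (1 - T Y)⁻¹ gains the factor T. -/
lemma regularAt_coeff_inv (hT : T * sqrtT P i ^ (-2 : ℤ) ∈ integralMonomials P)
    (hY : Y ∈ regularRing P) (hY0 : Y ≠ 0) :
    RegularAt (T * (sqrtT P i)⁻¹) ((mono P 0 ((sqrtT P i : (Kqt P)ˣ) : Kqt P) -
      (mono P 0 ((sqrtT P i : (Kqt P)ˣ) : Kqt P))⁻¹) *
        ((mono P 0 (T : Kqt P) * Y)⁻¹ - 1)⁻¹) := by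
  obtain ⟨h1, h2⟩ := one_sub_inv_mem hT hY
  have hT0 : mono P 0 (T : Kqt P) ≠ 0 := mono_ne_zero P _ _ T.ne_zero
  have e : ((mono P 0 (T : Kqt P) * Y)⁻¹ - 1)⁻¹ =
      mono P 0 (T : Kqt P) * (Y * (1 - mono P 0 (T : Kqt P) * Y)⁻¹) := by
    have h3 : (mono P 0 (T : Kqt P) * Y)⁻¹ - 1 =
        (mono P 0 (T : Kqt P) * Y)⁻¹ * (1 - mono P 0 (T : Kqt P) * Y) := by
      rw [mul_sub, mul_one, inv_mul_cancel₀ (mul_ne_zero hT0 hY0)]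
    rw [h3, mul_inv, inv_inv, mul_assoc]
  rw [e, mul_comm T]
  have h4 := ((regularAt_mono T).mul (regularAt_one.2 (mul_mem hY h2)))
  rw [mul_one] at h4
  exact (regularAt_sqrtT_sub_inv i).mul h4

lemma regularAt_coeff (hT : T * sqrtT P i ^ (-2 : ℤ) ∈ integralMonomials P)
    (hY : Y ∈ regularRing P) :
    RegularAt (sqrtT P i)⁻¹ ((mono P 0 ((sqrtT P i : (Kqt P)ˣ) : Kqt P) -
      (mono P 0 ((sqrtT P i : (Kqt P)ˣ) : Kqt P))⁻¹) * (mono P 0 (T : Kqt P) * Y - 1)⁻¹) := by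
  obtain ⟨h1, h2⟩ := one_sub_inv_mem hT hY
  have h3 := (regularAt_sqrtT_sub_inv i).mul (regularAt_one.2 h2).neg
  rw [mul_one] at h3
  convert h3 using 2
  rw [← inv_neg, neg_sub]

/-- With X = T Y one has (X - 1)⁻¹ + 1 = X (X - 1)⁻¹, so the scalar term of T_i⁻¹ gains the factor T
that the one of T_i lacks. -/
lemma regularAt_coeff_add (hT : T * sqrtT P i ^ (-2 : ℤ) ∈ integralMonomials P)
    (hY : Y ∈ regularRing P) :
    RegularAt (T * (sqrtT P i)⁻¹) ((mono P 0 ((sqrtT P i : (Kqt P)ˣ) : Kqt P) -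
      (mono P 0 ((sqrtT P i : (Kqt P)ˣ) : Kqt P))⁻¹) * (mono P 0 (T : Kqt P) * Y - 1)⁻¹ +
      (mono P 0 ((sqrtT P i : (Kqt P)ˣ) : Kqt P) -
      (mono P 0 ((sqrtT P i : (Kqt P)ˣ) : Kqt P))⁻¹)) := by
  obtain ⟨h1, h2⟩ := one_sub_inv_mem hT hY
  have h3 := (regularAt_sqrtT_sub_inv i).mul
    (((regularAt_mono T).mul (regularAt_one.2 (mul_mem hY h2))).neg)
  rw [mul_one, mul_comm _ T] at h3
  convert h3 using 1
  have h4 : mono P 0 (T : Kqt P) * Y - 1 ≠ 0 := by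
    rw [← neg_ne_zero, neg_sub]
    exact h1
  have h5 : (1 - mono P 0 (T : Kqt P) * Y)⁻¹ = -(mono P 0 (T : Kqt P) * Y - 1)⁻¹ := by
    rw [← inv_neg, neg_sub]
  rw [h5]
  generalize mono P 0 ((sqrtT P i : (Kqt P)ˣ) : Kqt P) -
    (mono P 0 ((sqrtT P i : (Kqt P)ˣ) : Kqt P))⁻¹ = x at *
  generalize mono P 0 (T : Kqt P) = t at *
  field_simp
  ring

end Coefficients

end Regular

/-! ### Coefficients of difference-spin operators, bounds by monomial matrices, limits -/

section SpinCoefficients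

variable {ι M N : Type*} [Fintype ι] [AddCommGroup M] [Module ℝ M] [AddCommGroup N] [Module ℝ N]
  {P : RootPairing ι ℝ M N} [P.IsCrystallographic]

lemma rhoTwist_mono (b : P.Base) (a : weightLattice P) (r : Kqt P) :
    rhoTwist b (mono P a r) =
      mono P a (((rhoChar b (Multiplicative.ofAdd a))⁻¹ : (Kqt P)ˣ) * r) := by
  have h := IsFractionRing.ringEquivOfRingEquiv_algebraMap (K := RatX P (Kqt P))
    (L := RatX P (Kqt P)) (twist (rhoChar b)⁻¹) (AddMonoidAlgebra.single a r)
  rw [twist_single] at h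
  exact h

lemma rhoTwist_shiftAut (b : P.Base) (c : Multiplicative (weightLattice P))
    (f : RatX P (Kqt P)) :
    rhoTwist b (shiftAut P (Kqt P) c f) = shiftAut P (Kqt P) c (rhoTwist b f) := by
  have h : ∀ χ ψ : Multiplicative (weightLattice P) →* (Kqt P)ˣ,
      IsFractionRing.ringEquivOfRingEquivHom (AddMonoidAlgebra (Kqt P) (weightLattice P))
        (RatX P (Kqt P)) (twist χ) * IsFractionRing.ringEquivOfRingEquivHom _ _ (twist ψ) =
      IsFractionRing.ringEquivOfRingEquivHom _ _ (twist ψ) *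
        IsFractionRing.ringEquivOfRingEquivHom _ _ (twist χ) := fun χ ψ => by
    rw [← map_mul, ← map_mul, ← map_mul, ← map_mul, mul_comm χ ψ]
  exact RingEquiv.congr_fun (h (rhoChar b)⁻¹ (qchar P (Kqt P) c)) f

lemma weylAut_shiftAut (w : P.weylGroup) (c : Multiplicative (weightLattice P))
    (f : RatX P (Kqt P)) :
    weylAut P (Kqt P) w (shiftAut P (Kqt P) c f) =
      shiftAut P (Kqt P) (weylOnLattice P w c) (weylAut P (Kqt P) w f) := by
  have h := congrArg (IsFractionRing.ringEquivOfRingEquivHom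
    (AddMonoidAlgebra (Kqt P) (weightLattice P)) (RatX P (Kqt P))) (permute_mul_twist P (Kqt P) w c)
  rw [map_mul, map_mul] at h
  exact RingEquiv.congr_fun h f

/-- The contribution of the term `f g` of a difference-reflection operator to the `u`-th component
of the conjugated difference-spin operator. -/
def spinCoeff (b : P.Base) (u : P.weylGroup) (g : ExtAffineWeyl P) (f : RatX P (Kqt P)) :
    RatX P (Kqt P) :=
  mono P 0 (rhoChar b (Multiplicative.ofAdd (u⁻¹ • g.left.toAdd)) : Kqt P) *
    rhoTwist b (weylAut P (Kqt P) u⁻¹ f)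

variable (b : P.Base)

lemma spinCoeff_zero (u : P.weylGroup) (g : ExtAffineWeyl P) : spinCoeff b u g 0 = 0 := by
  rw [spinCoeff, map_zero, map_zero, mul_zero]

lemma spinCoeff_add (u : P.weylGroup) (g : ExtAffineWeyl P) (f f' : RatX P (Kqt P)) :
    spinCoeff b u g (f + f') = spinCoeff b u g f + spinCoeff b u g f' := by
  rw [spinCoeff, map_add, map_add, mul_add]; rfl

/-- The cocycle rule behind the matrix picture: row u of a product uses row g⁻¹u of the second
factor, up to a shift Γ that does not affect orders in t. -/
lemma spinCoeff_mul (u : P.weylGroup) (g h : ExtAffineWeyl P) (f f' : RatX P (Kqt P)) :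
    spinCoeff b u (g * h) (f * g • f') = spinCoeff b u g f *
      shiftAut P (Kqt P) (weylOnLattice P u⁻¹ g.left⁻¹) (spinCoeff b (g.right⁻¹ * u) h f') := by
  have e1 : rhoChar b (Multiplicative.ofAdd (u⁻¹ • (g * h).left.toAdd)) =
      rhoChar b (Multiplicative.ofAdd (u⁻¹ • g.left.toAdd)) *
        rhoChar b (Multiplicative.ofAdd ((g.right⁻¹ * u)⁻¹ • h.left.toAdd)) := by
    rw [← map_mul, ← ofAdd_add]
    congr 2
    change u⁻¹ • (g.left.toAdd + g.right • h.left.toAdd) = _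
    rw [smul_add, mul_inv_rev, inv_inv, mul_smul]
  have e2 : weylAut P (Kqt P) u⁻¹ (g • f') =
      shiftAut P (Kqt P) (weylOnLattice P u⁻¹ g.left⁻¹)
        (weylAut P (Kqt P) (g.right⁻¹ * u)⁻¹ f') := by
    change weylAut P (Kqt P) u⁻¹ (shiftAut P (Kqt P) g.left⁻¹ (weylAut P (Kqt P) g.right f')) = _
    rw [weylAut_shiftAut, mul_inv_rev, inv_inv, map_mul]
    rfl
  rw [spinCoeff, spinCoeff, spinCoeff, e1, mono_units_mul, map_mul, map_mul, e2, rhoTwist_shiftAut,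
    map_mul, shiftAut_mono, ofAdd_zero, map_one, Units.val_one, one_mul]
  ring

/-- All coefficients of the conjugated difference-spin operator of `A` from the component `v` to the
component `u` are products of the monomial `m u v` and regular functions. -/
def BoundedBy (A : DiffRefl P) (m : P.weylGroup → P.weylGroup → (Kqt P)ˣ) : Prop :=
  ∀ u g, RegularAt (m u (g.right⁻¹ * u)) (spinCoeff b u g (A.coeff g))

variable {b} {m m' : P.weylGroup → P.weylGroup → (Kqt P)ˣ}

lemma BoundedBy.add {A B : DiffRefl P} (hA : BoundedBy b A m) (hB : BoundedBy b B m) :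
    BoundedBy b (A + B) m := fun u g => by
  rw [SkewMonoidAlgebra.coeff_add, Finsupp.add_apply, spinCoeff_add]
  exact (hA u g).add (hB u g)

lemma boundedBy_zero : BoundedBy b 0 m := fun u g => by
  rw [SkewMonoidAlgebra.coeff_zero, Finsupp.zero_apply, spinCoeff_zero]
  exact regularAt_zero _

lemma boundedBy_single {g : ExtAffineWeyl P} {f : RatX P (Kqt P)}
    (h : ∀ u, RegularAt (m u (g.right⁻¹ * u)) (spinCoeff b u g f)) :
    BoundedBy b (SkewMonoidAlgebra.single g f) m := fun u g' => by
  classical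
  rw [SkewMonoidAlgebra.coeff_single_apply]
  split_ifs with hg
  · rw [← hg]
    exact h u
  · rw [spinCoeff_zero]
    exact regularAt_zero _

lemma BoundedBy.single_mul {A : DiffRefl P} (hA : BoundedBy b A m') {g : ExtAffineWeyl P}
    {f : RatX P (Kqt P)}
    (h : ∀ u v, RegularAt (m u v * (m' (g.right⁻¹ * u) v)⁻¹) (spinCoeff b u g f)) :
    BoundedBy b (SkewMonoidAlgebra.single g f * A) m := fun u g' => by
  rw [SkewMonoidAlgebra.coeff_single_mul]
  have e := spinCoeff_mul b u g (g⁻¹ * g') f (A.coeff (g⁻¹ * g'))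
  rw [mul_inv_cancel_left] at e
  rw [e]
  have h1 := (h u (g'.right⁻¹ * u)).mul ((hA (g.right⁻¹ * u) (g⁻¹ * g')).shiftAut
    (weylOnLattice P u⁻¹ g.left⁻¹))
  have e2 : (g⁻¹ * g').right⁻¹ * (g.right⁻¹ * u) = g'.right⁻¹ * u := by
    change (g.right⁻¹ * g'.right)⁻¹ * (g.right⁻¹ * u) = _
    group
  rwa [e2, inv_mul_cancel_right] at h1

lemma BoundedBy.mul_single {A : DiffRefl P} (hA : BoundedBy b A m') {g : ExtAffineWeyl P}
    {f : RatX P (Kqt P)}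
    (h : ∀ u v, RegularAt (m u (g.right⁻¹ * v) * (m' u v)⁻¹) (spinCoeff b v g f)) :
    BoundedBy b (A * SkewMonoidAlgebra.single g f) m := fun u g' => by
  rw [SkewMonoidAlgebra.coeff_mul_single]
  have e := spinCoeff_mul b u (g' * g⁻¹) g (A.coeff (g' * g⁻¹)) f
  rw [inv_mul_cancel_right] at e
  rw [e]
  have h1 := (hA u (g' * g⁻¹)).mul ((h u ((g' * g⁻¹).right⁻¹ * u)).shiftAut
    (weylOnLattice P u⁻¹ (g' * g⁻¹).left⁻¹))
  have e2 : g.right⁻¹ * ((g' * g⁻¹).right⁻¹ * u) = g'.right⁻¹ * u := by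
    change g.right⁻¹ * ((g'.right * g.right⁻¹)⁻¹ * u) = _
    group
  rwa [mul_comm (m' _ _), inv_mul_cancel_right, e2] at h1

variable (b) in
/-- The operator has a limit after the conjugation. -/
def IsRegularOp (A : DiffRefl P) : Prop := BoundedBy b A fun _ _ => 1

lemma isRegularOp_one : IsRegularOp b 1 := by
  rw [SkewMonoidAlgebra.one_def]
  refine boundedBy_single fun u => regularAt_one.2 ?_
  have e : spinCoeff b u 1 1 = 1 := by
    rw [spinCoeff, map_one, map_one, mul_one]
    change mono P 0 ((rhoChar b (Multiplicative.ofAdd (u⁻¹ • (0 : weightLattice P))) : (Kqt P)ˣ) :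
      Kqt P) = 1
    rw [smul_zero, ofAdd_zero, map_one, Units.val_one, mono_zero_one]
  rw [e]
  exact one_mem _

/-- The first factor is split into its finitely many terms, and each is a regular multiple of a
shifted row of the second. -/
lemma IsRegularOp.mul {A B : DiffRefl P} (hA : IsRegularOp b A) (hB : IsRegularOp b B) :
    IsRegularOp b (A * B) := by
  have h : ∀ s : Finset (ExtAffineWeyl P),
      IsRegularOp b ((∑ g ∈ s, SkewMonoidAlgebra.single g (A.coeff g)) * B) := fun s => by
    classical
    induction s using Finset.induction_on with
    | empty =>
      rw [Finset.sum_empty, zero_mul]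
      exact boundedBy_zero
    | insert g s hg ih =>
      rw [Finset.sum_insert hg, add_mul]
      refine BoundedBy.add (BoundedBy.single_mul hB fun u v => ?_) ih
      rw [inv_one, mul_one]
      exact hA u g
  have e : A = ∑ g ∈ A.support, SkewMonoidAlgebra.single g (A.coeff g) :=
    (SkewMonoidAlgebra.sum_single A).symm
  rw [e]
  exact h _

lemma IsRegularOp.pow {A : DiffRefl P} (hA : IsRegularOp b A) (n : ℕ) :
    IsRegularOp b (A ^ n) := by
  induction n with
  | zero => rw [pow_zero]; exact isRegularOp_one
  | succ n ih => rw [pow_succ]; exact ih.mul hA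

lemma IsRegularOp.zpow {A : (DiffRefl P)ˣ} (h1 : IsRegularOp b A.val)
    (h2 : IsRegularOp b A⁻¹.val) (n : ℤ) : IsRegularOp b (A ^ n).val := by
  obtain ⟨n, rfl | rfl⟩ := n.eq_nat_or_neg
  · rw [zpow_natCast, Units.val_pow_eq_pow_val]
    exact h1.pow n
  · rw [zpow_neg, zpow_natCast, ← inv_pow, Units.val_pow_eq_pow_val]
    exact h2.pow n

section Limit

variable [P.IsRootSystem]

/-- The `u`-th component of a spinor. -/
def spinorEval (P : RootPairing ι ℝ M N) [P.IsCrystallographic] (k : Type*) [Field k]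
    [Algebra Kq k] [P.IsRootSystem] (u : P.weylGroup) : Spinor P k →+ RatX P k where
  toFun f := f u
  map_zero' := rfl
  map_add' _ _ := rfl

lemma coeff_sum_single {G k k' : Type*} [AddCommMonoid k] [AddCommMonoid k']
    (A : SkewMonoidAlgebra k G) (F : G → k → k') (hF : ∀ g, F g 0 = 0) (g : G) :
    (A.sum fun g f => SkewMonoidAlgebra.single g (F g f)).coeff g = F g (A.coeff g) := by
  classical
  rw [SkewMonoidAlgebra.coeff_sum, SkewMonoidAlgebra.sum_def', Finset.sum_eq_single g]
  · rw [SkewMonoidAlgebra.coeff_single_apply, if_pos rfl]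
  · intro g' _ hne
    rw [SkewMonoidAlgebra.coeff_single_apply, if_neg hne]
  · intro hg
    rw [SkewMonoidAlgebra.coeff_single_apply, if_pos rfl,
      SkewMonoidAlgebra.notMem_support_iff.1 hg, hF]

lemma rhoConj_coeff (A : SpinOp P (Kqt P)) (g : Multiplicative (weightLattice P) × P.weylGroup)
    (u : P.weylGroup) : (rhoConj b A).coeff g u =
      mono P 0 ((rhoChar b g.1)⁻¹ : (Kqt P)ˣ).val * rhoTwist b (A.coeff g u) := by
  have := coeff_sum_single A
    (fun g f => (fun u => mono P 0 ((rhoChar b g.1)⁻¹ : (Kqt P)ˣ).val * rhoTwist b (f u) :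
      Spinor P (Kqt P))) (fun g => ?_) g
  · exact congrFun this u
  · funext u
    change _ * rhoTwist b 0 = 0
    rw [map_zero, mul_zero]

lemma spinorOf_zero : spinorOf P (Kqt P) 0 = 0 := funext fun u => map_zero (weylAut P (Kqt P) u⁻¹)

lemma spinorOf_add (f f' : RatX P (Kqt P)) :
    spinorOf P (Kqt P) (f + f') = spinorOf P (Kqt P) f + spinorOf P (Kqt P) f' :=
  funext fun u => map_add (weylAut P (Kqt P) u⁻¹) f f'

lemma smul_zeta (c : Multiplicative (weightLattice P)) (u : P.weylGroup) :
    ((c, 1) : Multiplicative (weightLattice P) × P.weylGroup) • zeta P (Kqt P) u =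
      zeta P (Kqt P) u := by
  classical
  funext v
  change shiftAut P (Kqt P) c (if 1⁻¹ * v = u then 1 else 0) = if v = u then 1 else 0
  rw [inv_one, one_mul]
  split_ifs
  · exact map_one _
  · exact map_zero _

lemma toSpin_zero : toSpin P (Kqt P) 0 = 0 := SkewMonoidAlgebra.sum_zero_index

lemma toSpin_add (A B : DiffRefl P) :
    toSpin P (Kqt P) (A + B) = toSpin P (Kqt P) A + toSpin P (Kqt P) B := by
  refine SkewMonoidAlgebra.sum_add_index' (fun g => ?_) (fun g f f' => ?_)
  · rw [spinorOf_zero, SkewMonoidAlgebra.single_zero_right, zero_mul, zero_mul]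
  · rw [spinorOf_add, SkewMonoidAlgebra.single_add, add_mul, add_mul]

lemma toSpin_single (g : ExtAffineWeyl P) (f : RatX P (Kqt P)) :
    toSpin P (Kqt P) (SkewMonoidAlgebra.single g f) =
      ∑ u : P.weylGroup, SkewMonoidAlgebra.single
        (Multiplicative.ofAdd (u⁻¹ • (-g.left.toAdd)), g.right)
        (spinorOf P (Kqt P) f * zeta P (Kqt P) u) := by
  rw [toSpin, SkewMonoidAlgebra.sum_single_index, spinorShift, Finset.mul_sum, Finset.sum_mul]
  · refine Finset.sum_congr rfl fun u _ => ?_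
    rw [SkewMonoidAlgebra.single_mul_single, SkewMonoidAlgebra.single_mul_single,
      SkewMonoidAlgebra.single_mul_single, smul_zeta, one_smul, smul_one, mul_one, mul_one, one_mul,
      one_mul, Prod.mk_mul_mk, mul_one, one_mul]
  · rw [spinorOf_zero, SkewMonoidAlgebra.single_zero_right, zero_mul, zero_mul]

/-- Since ζ_u picks Γ_{u⁻¹b} from ϱ(Γ_b), each component of a coefficient of the spin operator comes
from a single term of A; the sign reflects that b acts as Γ_{-b}. -/
lemma toSpin_coeff (A : DiffRefl P) (g : Multiplicative (weightLattice P) × P.weylGroup)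
    (u : P.weylGroup) : (toSpin P (Kqt P) A).coeff g u = weylAut P (Kqt P) u⁻¹
      (A.coeff ⟨Multiplicative.ofAdd (-(u • g.1.toAdd)), g.2⟩) := by
  classical
  induction A using SkewMonoidAlgebra.induction_on with
  | zero =>
    rw [toSpin_zero]
    exact (map_zero (weylAut P (Kqt P) u⁻¹)).symm
  | add A B hA hB =>
    rw [toSpin_add, SkewMonoidAlgebra.coeff_add, SkewMonoidAlgebra.coeff_add, Finsupp.add_apply,
      Finsupp.add_apply, map_add, ← hA, ← hB]
    rfl
  | single h f =>
    let ev : SpinOp P (Kqt P) →+ RatX P (Kqt P) :=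
      ((spinorEval P (Kqt P) u).comp (Finsupp.applyAddHom g)).comp
        SkewMonoidAlgebra.coeffAddEquiv.toAddMonoidHom
    change ev (toSpin P (Kqt P) (SkewMonoidAlgebra.single h f)) = _
    rw [toSpin_single, map_sum, Finset.sum_eq_single u]
    · have e1 : ∀ (x : Spinor P (Kqt P)) k, ev (SkewMonoidAlgebra.single k x) =
          if k = g then x u else 0 := by
        intro x k
        change (SkewMonoidAlgebra.single k x).coeff g u = _
        rw [SkewMonoidAlgebra.coeff_single_apply]
        split_ifs <;> rfl
      have e2 : (spinorOf P (Kqt P) f * zeta P (Kqt P) u) u = weylAut P (Kqt P) u⁻¹ f := by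
        change weylAut P (Kqt P) u⁻¹ f * (if u = u then 1 else 0) = _
        rw [if_pos rfl, mul_one]
      rw [e1, e2, SkewMonoidAlgebra.coeff_single_apply]
      have e3 : ((Multiplicative.ofAdd (u⁻¹ • (-h.left.toAdd)), h.right) = g) ↔
          h = ⟨Multiplicative.ofAdd (-(u • g.1.toAdd)), g.2⟩ := by
        constructor
        · rintro rfl
          refine SemidirectProduct.ext ?_ rfl
          change h.left = Multiplicative.ofAdd (-(u • (u⁻¹ • (-h.left.toAdd))))
          rw [smul_inv_smul, neg_neg, ofAdd_toAdd]
        · rintro rfl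
          refine Prod.ext ?_ rfl
          change Multiplicative.ofAdd (u⁻¹ • (- -(u • g.1.toAdd))) = g.1
          rw [neg_neg, inv_smul_smul, ofAdd_toAdd]
      by_cases h4 : h = ⟨Multiplicative.ofAdd (-(u • g.1.toAdd)), g.2⟩
      · rw [if_pos (e3.2 h4), if_pos h4]
      · rw [if_neg fun h5 => h4 (e3.1 h5), if_neg h4, map_zero]
    · intro v _ hv
      change (SkewMonoidAlgebra.single _ (spinorOf P (Kqt P) f * zeta P (Kqt P) v)).coeff g u = 0
      rw [SkewMonoidAlgebra.coeff_single_apply]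
      split_ifs
      · change _ * (if u = v then 1 else 0) = (0 : RatX P (Kqt P))
        rw [if_neg hv.symm, mul_zero]
      · rfl
    · exact fun h => absurd (Finset.mem_univ _) h

lemma IsRegularOp.exists_isRE {A : DiffRefl P} (hA : IsRegularOp b A) : ∃ L, IsRE b A L := by
  classical
  have hreg : ∀ g u, ∃ l, IsLimit P ((rhoConj b (toSpin P (Kqt P) A)).coeff g u) l := by
    intro g u
    rw [rhoConj_coeff, toSpin_coeff, ← mem_regularRing]
    have h := regularAt_one.1 (hA u ⟨Multiplicative.ofAdd (-(u • g.1.toAdd)), g.2⟩)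
    rw [spinCoeff] at h
    convert h using 4
    change (rhoChar b g.1)⁻¹ = rhoChar b (Multiplicative.ofAdd (u⁻¹ • (-(u • g.1.toAdd))))
    rw [smul_neg, inv_smul_smul, ofAdd_neg, map_inv, ofAdd_toAdd]
  -- The value at 0 is fixed to be 0 so that applying `lim` coefficientwise keeps the support
  -- finite.
  let lim : RatX P (Kqt P) → RatX P Kq := fun f =>
    if f = 0 then 0 else if h : ∃ l, IsLimit P f l then h.choose else 0
  have hlim : ∀ f, (∃ l, IsLimit P f l) → IsLimit P f (lim f) := by
    intro f hf
    by_cases h0 : f = 0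
    · rw [h0, show lim 0 = 0 from if_pos rfl]
      exact isLimit_zero
    · rw [show lim f = hf.choose from (if_neg h0).trans (dif_pos hf)]
      exact hf.choose_spec
  let L : SpinOp P Kq := ⟨Finsupp.mapRange
    (fun f : Spinor P (Kqt P) => (fun u => lim (f u) : Spinor P Kq))
    (funext fun u => if_pos rfl) (rhoConj b (toSpin P (Kqt P) A)).coeff⟩
  exact ⟨L, fun g u => hlim _ (hreg g u)⟩

end Limit

end SpinCoefficients

/-! ### Orders of the T_i, of products along words, and existence of the limits -/

section Limits

variable {ι M N : Type*} [Fintype ι] [AddCommGroup M] [Module ℝ M] [AddCommGroup N] [Module ℝ N]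
  {P : RootPairing ι ℝ M N} [P.IsCrystallographic]

variable (P) in
/-- The coefficient `(t^{1/2} - t^{-1/2}) (X - 1)⁻¹` of the operators `T_i`. -/
def lusztigCoeff (i : ι) (j : ℤ) : RatX P (Kqt P) :=
  (mono P 0 (sqrtT P i : Kqt P) - (mono P 0 (sqrtT P i : Kqt P))⁻¹) *
    (affineX P (Kqt P) i j - 1)⁻¹

variable (b : P.Base)

/-- The action of `u⁻¹` followed by the conjugation. -/
def twistAut (u : P.weylGroup) : RatX P (Kqt P) ≃+* RatX P (Kqt P) :=
  (weylAut P (Kqt P) u⁻¹).trans (rhoTwist b)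

lemma twistAut_mono (u : P.weylGroup) (a : weightLattice P) (r : Kqt P) :
    twistAut b u (mono P a r) = mono P (u⁻¹ • a)
      (((rhoChar b (Multiplicative.ofAdd (u⁻¹ • a)))⁻¹ : (Kqt P)ˣ) * r) := by
  change rhoTwist b (weylAut P (Kqt P) u⁻¹ (mono P a r)) = _
  rw [weylAut_mono, rhoTwist_mono]

lemma twistAut_mono_zero (u : P.weylGroup) (r : Kqt P) :
    twistAut b u (mono P 0 r) = mono P 0 r := by
  rw [twistAut_mono, smul_zero, ofAdd_zero, map_one, inv_one, Units.val_one, one_mul]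

lemma spinCoeff_one_left (u : P.weylGroup) (f : RatX P (Kqt P)) :
    spinCoeff b u 1 f = twistAut b u f := by
  change mono P 0 ((rhoChar b (Multiplicative.ofAdd (u⁻¹ • (0 : weightLattice P))) : (Kqt P)ˣ) :
    Kqt P) * twistAut b u f = _
  rw [smul_zero, ofAdd_zero, map_one, Units.val_one, mono_zero_one, one_mul]

lemma twistAut_lusztigCoeff (u : P.weylGroup) (i : ι) (j : ℤ) :
    twistAut b u (lusztigCoeff P i j) =
      (mono P 0 (sqrtT P (perm P u⁻¹ i) : Kqt P) -
        (mono P 0 (sqrtT P (perm P u⁻¹ i) : Kqt P))⁻¹) *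
          (twistAut b u (affineX P (Kqt P) i j) - 1)⁻¹ := by
  rw [lusztigCoeff, map_mul, map_inv₀, map_sub, map_sub, map_inv₀, map_one, twistAut_mono_zero,
    sqrtT_perm]

lemma twistAut_affineX_of_isPos (u : P.weylGroup) (i : ι) (j : ℤ) :
    ∃ Y ∈ regularRing P, Y ≠ 0 ∧ twistAut b u (affineX P (Kqt P) i j) =
      (mono P 0 (rhoChar b (Multiplicative.ofAdd (rootWeight P (perm P u⁻¹ i))) : Kqt P) * Y)⁻¹ := by
  refine ⟨mono P (-rootWeight P (perm P u⁻¹ i))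
    (algebraMap Kq (Kqt P) ((qpow P (nu P i * j))⁻¹ : Kqˣ)), mono_algebraMap_mem _ _,
    mono_ne_zero _ _ _ (by simp), ?_⟩
  refine eq_inv_of_mul_eq_one_left ?_
  rw [affineX, twistAut_mono, ← rootWeight_perm, mono_mul_mono, mono_mul_mono, zero_add,
    add_neg_cancel, mul_mul_mul_comm, ← Units.val_mul, inv_mul_cancel, ← map_mul, ← Units.val_mul,
    mul_inv_cancel, Units.val_one, Units.val_one, map_one, mul_one, mono_zero_one]

lemma twistAut_affineX_of_not_isPos (u : P.weylGroup) (i : ι) (j : ℤ) :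
    ∃ Y ∈ regularRing P, twistAut b u (affineX P (Kqt P) i j) =
      mono P 0 (rhoChar b (Multiplicative.ofAdd (rootWeight P (opp P (perm P u⁻¹ i)))) : Kqt P) *
        Y := by
  refine ⟨mono P (rootWeight P (perm P u⁻¹ i)) (algebraMap Kq (Kqt P) (qpow P (nu P i * j))),
    mono_algebraMap_mem _ _, ?_⟩
  rw [affineX, twistAut_mono, ← rootWeight_perm, mono_mul_mono, zero_add, rootWeight_opp, ofAdd_neg,
    map_inv]

lemma regularAt_twistAut_lusztigCoeff (u : P.weylGroup) (i : ι) (j : ℤ) :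
    RegularAt (diagMonomial b (perm P u⁻¹ i)) (twistAut b u (lusztigCoeff P i j)) := by
  rw [twistAut_lusztigCoeff]
  by_cases hγ : b.IsPos (perm P u⁻¹ i)
  · obtain ⟨Y, hY, hY0, e⟩ := twistAut_affineX_of_isPos b u i j
    rw [e, diagMonomial, if_pos hγ]
    exact regularAt_coeff_inv (rhoChar_rootWeight_mul_mem hγ) hY hY0
  · obtain ⟨Y, hY, e⟩ := twistAut_affineX_of_not_isPos b u i j
    rw [e, diagMonomial, if_neg hγ, one_mul]
    have h := rhoChar_rootWeight_mul_mem ((isPos_opp b).2 hγ)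
    rw [sqrtT_opp] at h
    exact regularAt_coeff h hY

/-- Passing from T_i to T_i⁻¹ replaces (X - 1)⁻¹ by X (X - 1)⁻¹ = -(X⁻¹ - 1)⁻¹, so the relevant root
changes sign. -/
lemma regularAt_twistAut_lusztigCoeff_add (u : P.weylGroup) (i : ι) (j : ℤ) :
    RegularAt (diagMonomial b (opp P (perm P u⁻¹ i))) (twistAut b u (lusztigCoeff P i j +
      (mono P 0 (sqrtT P i : Kqt P) - (mono P 0 (sqrtT P i : Kqt P))⁻¹))) := by
  rw [map_add, map_sub, map_inv₀, twistAut_mono_zero, twistAut_lusztigCoeff,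
    ← sqrtT_perm u⁻¹ i]
  by_cases hγ : b.IsPos (perm P u⁻¹ i)
  · obtain ⟨Y, hY, hY0, e⟩ := twistAut_affineX_of_isPos b u i j
    rw [e, diagMonomial, if_neg (by rw [isPos_opp]; simpa using hγ), one_mul, sqrtT_opp]
    refine RegularAt.add ?_ (regularAt_sqrtT_sub_inv _)
    have h := rhoChar_rootWeight_mul_mem hγ
    refine (regularAt_coeff_inv h hY hY0).of_mem ?_
    rw [inv_inv, inv_mul_cancel_right]
    have h2 := mul_mem h (sqrtT_zpow_mem (P := P) (perm P u⁻¹ i) (n := 2) (by norm_num))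
    rwa [mul_assoc, ← zpow_add, neg_add_cancel, zpow_zero, mul_one] at h2
  · obtain ⟨Y, hY, e⟩ := twistAut_affineX_of_not_isPos b u i j
    have h := rhoChar_rootWeight_mul_mem ((isPos_opp b).2 hγ)
    rw [e, diagMonomial, if_pos ((isPos_opp b).2 hγ), sqrtT_opp]
    rw [sqrtT_opp] at h
    exact regularAt_coeff_add h hY

-- For positive γ the ρ-factor is divisible by t_i and leaves order t_i^{1/2}; for negative γ the
-- pole t_i^{-1/2} survives.
open scoped Classical in
lemma regularAt_twistAut_add_lusztigCoeff (u : P.weylGroup) (i : ι) (j : ℤ) :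
    RegularAt (if b.IsPos (perm P u⁻¹ i) then sqrtT P i else (sqrtT P i)⁻¹)
      (twistAut b u (mono P 0 (sqrtT P i : Kqt P) + lusztigCoeff P i j)) := by
  rw [map_add, twistAut_mono_zero]
  have h1 := regularAt_twistAut_lusztigCoeff b u i j
  split_ifs with hγ
  · refine (regularAt_mono _).add (h1.of_mem ?_)
    rw [diagMonomial, if_pos hγ, sqrtT_perm, mul_assoc, ← zpow_neg_one (sqrtT P i), ← zpow_add]
    have h := rhoChar_rootWeight_mul_mem hγ
    rw [sqrtT_perm] at h
    exact h
  · rw [diagMonomial, if_neg hγ, one_mul, sqrtT_perm] at h1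
    refine RegularAt.add ((regularAt_mono _).of_mem ?_) h1
    rw [inv_inv]
    exact mul_mem (sqrtT_mem i) (sqrtT_mem i)

variable [P.IsRootSystem] [P.IsIrreducible]

lemma simpleT_val (k : Option b.support) : (simpleT b k).val =
    SkewMonoidAlgebra.single (simpleReflection b k) (mono P 0 (sqrtT P (affineSimple b k).1 : Kqt P) +
      lusztigCoeff P (affineSimple b k).1 (affineSimple b k).2) +
    SkewMonoidAlgebra.single 1 (-lusztigCoeff P (affineSimple b k).1 (affineSimple b k).2) :=
  demazureLusztigVal_eq _ _ _

/-- The quadratic relation gives T_k⁻¹ = T_k - (t_k^{1/2} - t_k^{-1/2}), which alters only the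
scalar term. -/
lemma simpleT_inv_val (k : Option b.support) : (simpleT b k)⁻¹.val =
    SkewMonoidAlgebra.single (simpleReflection b k) (mono P 0 (sqrtT P (affineSimple b k).1 : Kqt P) +
      lusztigCoeff P (affineSimple b k).1 (affineSimple b k).2) +
    SkewMonoidAlgebra.single 1 (-(lusztigCoeff P (affineSimple b k).1 (affineSimple b k).2 +
      (mono P 0 (sqrtT P (affineSimple b k).1 : Kqt P) -
        (mono P 0 (sqrtT P (affineSimple b k).1 : Kqt P))⁻¹))) := by
  have e : (simpleT b k)⁻¹.val = (simpleT b k).val - SkewMonoidAlgebra.single 1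
      (mono P 0 (sqrtT P (affineSimple b k).1 : Kqt P) -
        (mono P 0 (sqrtT P (affineSimple b k).1 : Kqt P))⁻¹) := rfl
  rw [e, simpleT_val, neg_add, SkewMonoidAlgebra.single_add 1, ← add_assoc, sub_eq_add_neg]
  congr 1
  exact (SkewMonoidAlgebra.single_neg _ _).symm

section Reduced

variable [P.IsReduced]

/-- The factor t_k^{∓1/2} in the ρ-character of the reflection cancels the order t_k^{±1/2} of the
coefficient in both sign cases, and only the ratio of inversion monomials remains. -/
lemma regularAt_spinCoeff_simpleReflection (u : P.weylGroup) (k : Option b.support) :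
    RegularAt (inversionMonomial b ((simpleReflection b k).right⁻¹ * u) * (inversionMonomial b u)⁻¹)
      (spinCoeff b u (simpleReflection b k) (mono P 0 (sqrtT P (affineSimple b k).1 : Kqt P) +
        lusztigCoeff P (affineSimple b k).1 (affineSimple b k).2)) := by
  classical
  have h := (regularAt_mono (rhoChar b (Multiplicative.ofAdd
    (u⁻¹ • (simpleReflection b k).left.toAdd)))).mul
      (regularAt_twistAut_add_lusztigCoeff b u (affineSimple b k).1 (affineSimple b k).2)
  refine RegularAt.of_mem h ?_
  rw [rhoChar_simpleReflection]
  split_ifs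
  · rw [inv_mul_cancel_right, mul_inv_cancel]
    exact one_mem _
  · rw [mul_inv_cancel_right, mul_inv_cancel]
    exact one_mem _

/-- A word all of whose affine roots `s_{i_l} ⋯ s_{i_{k+1}} (α_{i_k})` have positive finite
parts. -/
def IsPositiveWord (L : List (Option b.support)) : Prop :=
  ∀ L₁ k L₂, L = L₁ ++ k :: L₂ →
    b.IsPos (perm P ((L₂.map (simpleReflection b)).prod).right⁻¹ (affineSimple b k).1)

variable {b}

lemma IsPositiveWord.tail {k : Option b.support} {L : List (Option b.support)}
    (h : IsPositiveWord b (k :: L)) : IsPositiveWord b L := fun L₁ k' L₂ e =>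
  h (k :: L₁) k' L₂ (by rw [e, List.cons_append])

lemma isPos_perm_opp {k : Option b.support} {w : P.weylGroup}
    (h : b.IsPos (perm P w⁻¹ (affineSimple b k).1)) (u : P.weylGroup) :
    b.IsPos (perm P (((simpleReflection b k).right * w)⁻¹ * u)
      (opp P (perm P u⁻¹ (affineSimple b k).1))) := by
  have e : (simpleReflection b k).right⁻¹ = refl P (affineSimple b k).1 := refl_inv _
  rw [perm_mul, perm_opp, perm_perm_inv, mul_inv_rev, perm_mul, e, ← perm_refl_self, ← perm_mul (refl P _),
    refl_mul_self, perm_one]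
  exact h

lemma mul_refl_opp (k : Option b.support) (w u : P.weylGroup) :
    (((simpleReflection b k).right * w)⁻¹ * u) * refl P (opp P (perm P u⁻¹ (affineSimple b k).1)) =
      w⁻¹ * u := by
  have e : (simpleReflection b k).right⁻¹ = refl P (affineSimple b k).1 := refl_inv _
  rw [refl_opp, refl_perm, mul_inv_rev, e, inv_inv, mul_assoc, ← mul_assoc u, ← mul_assoc u,
    mul_inv_cancel, one_mul, mul_assoc, ← mul_assoc (refl P _), refl_mul_self, one_mul]

/-- The rows of the product of the `T_i` along a positive word. -/
lemma boundedBy_prod_simpleT {L : List (Option b.support)} (h : IsPositiveWord b L) :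
    BoundedBy b ((L.map (simpleT b)).prod).val fun u _ =>
      inversionMonomial b (((L.map (simpleReflection b)).prod).right⁻¹ * u) *
        (inversionMonomial b u)⁻¹ := by
  induction L with
  | nil =>
    have e : (fun u _ => inversionMonomial b
        (((([] : List (Option b.support)).map (simpleReflection b)).prod).right⁻¹ * u) *
          (inversionMonomial b u)⁻¹ : P.weylGroup → P.weylGroup → (Kqt P)ˣ) = fun _ _ => 1 := by
      funext u v
      rw [List.map_nil, List.prod_nil, SemidirectProduct.one_right, inv_one, one_mul,
        mul_inv_cancel]
    rw [e]
    exact isRegularOp_one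
  | cons k L ih =>
    have hk := h [] k L rfl
    have e : (((k :: L).map (simpleReflection b)).prod).right =
        (simpleReflection b k).right * ((L.map (simpleReflection b)).prod).right := by
      rw [List.map_cons, List.prod_cons, SemidirectProduct.mul_right]
    rw [e]
    rw [List.map_cons, List.prod_cons, Units.val_mul, simpleT_val, add_mul]
    generalize ((L.map (simpleReflection b)).prod).right = w at hk ih ⊢
    refine ((ih h.tail).single_mul fun u v => ?_).add ((ih h.tail).single_mul fun u v => ?_)
    -- The s_k-term moves from row u to row s_k u, and the ratios of inversion monomials telescope.
    · have h1 := regularAt_spinCoeff_simpleReflection b u k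
      convert h1 using 1
      rw [mul_inv_rev _ w, mul_assoc w⁻¹]
      simp only [← div_eq_mul_inv]
      exact div_div_div_cancel_left _ _ _
    · rw [spinCoeff_one_left, map_neg]
      refine ((regularAt_twistAut_lusztigCoeff b u _ _).of_mem ?_).neg
      -- The scalar term stays in row u, where the old and new bounds differ by a reflection: (s_k
      -- w)⁻¹u against w⁻¹u. The positivity needed is that of w⁻¹α_k, supplied by the word.
      have h1 := diagMonomial_row (isPos_perm_opp hk u)
      rw [mul_refl_opp, opp_opp] at h1
      convert h1 using 2
      rw [SemidirectProduct.one_right, inv_one, one_mul]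
      group

/-- The columns of the inverse of the product of the `T_i` along a positive word. -/
lemma boundedBy_prod_simpleT_inv {L : List (Option b.support)} (h : IsPositiveWord b L) :
    BoundedBy b ((L.map (simpleT b)).prod)⁻¹.val fun _ v => inversionMonomial b v *
      (inversionMonomial b (((L.map (simpleReflection b)).prod).right⁻¹ * v))⁻¹ := by
  induction L with
  | nil =>
    have e : (fun _ v => inversionMonomial b v * (inversionMonomial b
        (((([] : List (Option b.support)).map (simpleReflection b)).prod).right⁻¹ * v))⁻¹ :
          P.weylGroup → P.weylGroup → (Kqt P)ˣ) = fun _ _ => 1 := by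
      funext u v
      rw [List.map_nil, List.prod_nil, SemidirectProduct.one_right, inv_one, one_mul,
        mul_inv_cancel]
    rw [e, List.map_nil, List.prod_nil, inv_one]
    exact isRegularOp_one
  | cons k L ih =>
    have hk := h [] k L rfl
    have e : (((k :: L).map (simpleReflection b)).prod).right =
        (simpleReflection b k).right * ((L.map (simpleReflection b)).prod).right := by
      rw [List.map_cons, List.prod_cons, SemidirectProduct.mul_right]
    rw [e]
    rw [List.map_cons, List.prod_cons, mul_inv_rev, Units.val_mul, simpleT_inv_val, mul_add]
    generalize ((L.map (simpleReflection b)).prod).right = w at hk ih ⊢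
    refine ((ih h.tail).mul_single fun u v => ?_).add ((ih h.tail).mul_single fun u v => ?_)
    · have h1 := regularAt_spinCoeff_simpleReflection b v k
      convert h1 using 1
      have hs : (simpleReflection b k).right⁻¹ * (simpleReflection b k).right⁻¹ = 1 := by
        rw [← mul_inv_rev, inv_eq_one]
        exact refl_mul_self _
      rw [mul_inv_rev _ w, mul_assoc w⁻¹, ← mul_assoc _ _ v, hs, one_mul]
      simp only [← div_eq_mul_inv]
      exact div_div_div_cancel_right _ _ _
    · rw [spinCoeff_one_left, map_neg]
      refine ((regularAt_twistAut_lusztigCoeff_add b v _ _).of_mem ?_).neg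
      -- The inverse factor multiplies on the right, so the comparison takes place in column v, with
      -- the same positive root.
      have h1 := diagMonomial_column (isPos_perm_opp hk v)
      rw [mul_refl_opp] at h1
      convert h1 using 2
      rw [SemidirectProduct.one_right, inv_one, one_mul]
      simp only [← div_eq_mul_inv]
      rw [div_div_div_cancel_left, inv_div]

lemma spinCoeff_of_affPos_iff (u : P.weylGroup) {g : ExtAffineWeyl P}
    (hg : ∀ v, AffPos b (affPerm g v) ↔ AffPos b v) : RegularAt
      (inversionMonomial b (g.right⁻¹ * u) * (inversionMonomial b u)⁻¹) (spinCoeff b u g 1) := by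
  rw [spinCoeff, map_one, map_one, mul_one, rhoChar_of_affPos_iff u hg]
  exact regularAt_mono _

/-- `T_c` and its inverse have limits for dominant weights `c`. -/
lemma isRegularOp_heckeT {c : weightLattice P} (hc : ∀ i, b.IsPos i → 0 ≤ pair P c i) :
    IsRegularOp b (heckeT b (translation P c)).val ∧
      IsRegularOp b (heckeT b (translation P c))⁻¹.val := by
  rw [heckeT]
  split_ifs with h
  · have hred := h.choose_spec
    generalize h.choose = p at hred ⊢
    obtain ⟨π, L⟩ := p
    have hL : IsPositiveWord b L := fun L₁ k L₂ e => hred.isPos hc e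
    have hπ := hred.1.1.affPos_iff
    have hπ' : ∀ v, AffPos b (affPerm π⁻¹ v) ↔ AffPos b v := fun v => by
      rw [← hπ (affPerm π⁻¹ v), ← affPerm_mul, mul_inv_cancel, affPerm_one]
    -- A translation has trivial finite part, so the finite part of π is w⁻¹ and its ratio of
    -- inversion monomials cancels that of the word.
    have hright : π.right * ((L.map (simpleReflection b)).prod).right = 1 := by
      have := congrArg SemidirectProduct.right hred.1.2
      exact this.symm
    have h1 := boundedBy_prod_simpleT hL
    have h2 := boundedBy_prod_simpleT_inv hL
    rw [← eq_inv_iff_mul_eq_one] at hright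
    generalize ((L.map (simpleReflection b)).prod).right = w at h1 h2 hright
    constructor
    · refine h1.single_mul fun u v => ?_
      convert spinCoeff_of_affPos_iff u hπ using 1
      rw [hright]
      group
    · rw [mul_inv_rev]
      refine h2.mul_single fun u v => ?_
      convert spinCoeff_of_affPos_iff v hπ' using 1
      rw [SemidirectProduct.inv_right, hright]
      group
  -- The default value 1 is regular too, so existence of a reduced decomposition is not needed here.
  · rw [inv_one]
    exact ⟨isRegularOp_one, isRegularOp_one⟩

lemma pair_fundamentalWeight_nonneg (r : b.support) {i : ι} (hi : b.IsPos i) :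
    0 ≤ pair P (fundamentalWeight b r) i := by
  classical
  have h := nonneg_of_isPos (x := (fundamentalWeight b r : M)) (fun k hk => ?_) hi
  · rw [pair_spec] at h
    exact_mod_cast h
  · change 0 ≤ P.toLinearMap (P.toLinearMap.toPerfPair.symm (b.toCoweightBasis.coord r)) _
    have e : P.coroot k = b.toCoweightBasis ⟨k, hk⟩ := (b.toCoweightBasis_apply ⟨k, hk⟩).symm
    rw [LinearMap.apply_symm_toPerfPair_self, e, Module.Basis.coord_apply,
      Module.Basis.repr_self, Finsupp.single_apply]
    split_ifs <;> norm_num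

variable (b) in
/-- The limits of all `Y_β` exist. -/
lemma exists_isRE_dunklY (β : weightLattice P) : ∃ L, IsRE b (dunklY b β).val L := by
  refine IsRegularOp.exists_isRE ?_
  rw [dunklY]
  -- Regularity is multiplicative for any order of the factors, so commutativity of the T_{ω_r}
  -- plays no role.
  generalize (Finset.univ : Finset b.support).toList = S
  induction S with
  | nil => exact isRegularOp_one
  | cons r S ih =>
    rw [List.map_cons, List.prod_cons, Units.val_mul]
    obtain ⟨h1, h2⟩ := isRegularOp_heckeT (c := fundamentalWeight b r)
      fun i hi => pair_fundamentalWeight_nonneg r hi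
    exact (h1.zpow h2 _).mul ih

end Reduced

end Limits

end TodaDunkl

end

theorem proposition5p4 {ι M N : Type*} [Fintype ι] [AddCommGroup M] [Module ℝ M]
    [AddCommGroup N] [Module ℝ N] (P : RootPairing ι ℝ M N) [P.IsRootSystem]
    [P.IsCrystallographic] [P.IsReduced] [P.IsIrreducible] (b : P.Base) :
    (∀ r : b.support, TodaDunkl.IsMinuscule b r →
      ∃ L, TodaDunkl.IsRE b (TodaDunkl.dunklY b (TodaDunkl.fundamentalWeight b r)).val L) ∧
    (∀ i : ι, TodaDunkl.IsShort P i → b.IsPos i →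
      ∃ L, TodaDunkl.IsRE b (TodaDunkl.dunklY b (TodaDunkl.rootWeight P i)).val L) ∧
    (∀ r : b.support, TodaDunkl.IsMinuscule b r →
      ∃ L, TodaDunkl.IsRE b (TodaDunkl.dunklY b (-TodaDunkl.fundamentalWeight b r)).val L) ∧
    (∀ i : ι, TodaDunkl.IsShort P i → ¬ b.IsPos i →
      ∃ L, TodaDunkl.IsRE b (TodaDunkl.dunklY b (TodaDunkl.rootWeight P i)).val L) ∧
    ∀ β : TodaDunkl.weightLattice P, ∃ L, TodaDunkl.IsRE b (TodaDunkl.dunklY b β).val L :=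
  ⟨fun _ _ => TodaDunkl.exists_isRE_dunklY b _, fun _ _ _ => TodaDunkl.exists_isRE_dunklY b _,
    fun _ _ => TodaDunkl.exists_isRE_dunklY b _, fun _ _ _ => TodaDunkl.exists_isRE_dunklY b _,
    TodaDunkl.exists_isRE_dunklY b⟩
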